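/- Write $q=e^{2\pi i\tau}$ and $q^{b}=e^{2\pi i b\tau}$ for $b\in\mathbb R$, where $\tau$ lies in the upper half-plane $\mathbb H$ and $z\in\mathbb C$. For real $k$ and $m>0$ let $$\theta_{k,m}(\tau,z)=\sum_{j\in\mathbb Z}e^{2\pi i m\left(j+\frac{k}{2m}\right)z}\,q^{m\left(j+\frac{k}{2m}\right)^2},$$ and for $m\in\frac12\mathbb N$, $s\in\frac12\mathbb Z$ let $\Phi^{[m;s]}=\Phi_1^{[m;s]}-\Phi_2^{[m;s]}$ with $$\Phi_1^{[m;s]}(\tau,z_1,z_2,t)=e^{-2\pi i m t}\sum_{j\in\mathbb Z}\frac{e^{2\pi i m j(z_1+z_2)+2\pi i s z_1}\,q^{mj^2+sj}}{1-e^{2\pi i z_1}q^j},$$ $$\Phi_2^{[m;s]}(\tau,z_1,z_2,t)=e^{-2\pi i m t}\sum_{j\in\mathbb Z}\frac{e^{-2\pi i m j(z_1+z_2)-2\pi i s z_2}\,q^{mj^2+sj}}{1-e^{-2\pi i z_2}q^j}.$$ Let $\mathbb C[[q^{1/2}]]$ be the $\mathbb C$-linear span of the functions $q^b\sum_{j\ge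 0}a_j(q^{1/2})^j$ on $\mathbb H$ ($b\in\mathbb R$, $a_j\in\mathbb C$, the series converging for all $\tau\in\mathbb H$), and let $\mathbb C((q^{1/2}))$ be the field of the quotients $f/g$ with $f,g\in\mathbb C[[q^{1/2}]]$, $g\neq 0$. For a positive integer $m$ define the following $\mathbb C((q^{1/2}))$-linear spans of meromorphic functions of $(\tau,z)\in\mathbb H\times\mathbb C$: - $V^{[m,\frac12]}$ is the span of the functions $\Phi^{[\frac m2;s]}\left(2\tau,\,z+\frac\tau2-\frac12,\,z-\frac\tau2+\frac12,\,\frac\tau8\right)$ with $s\in\frac12+\mathbb Z$, $\frac12\le s\le\frac{m+1}2$; - $V^{[m,0]}$ is the span of the same functions with $s\in\mathbb Z$, $1\le s\le\frac{m+1}2$; - $U^{[m,\frac12]}$ is the span of $\dfrac{\theta_{\frac12,m+1}(\tau,z)}{\theta_{-\frac12,1}(\tau,z)}-\dfrac{\theta_{-\frac12,m+1}(\tau,z)}{\theta_{\frac12,1}(\tau,z)}$ and of $\theta_{k,m}(\tau,z)-\theta_{-k,m}(\tau,z)$ with $k$ odd, $1\le k\le m-1$; - $U^{[m,0]}$ is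 the span of $\dfrac{\theta_{m+\frac12,m+1}(\tau,z)}{\theta_{-\frac12,1}(\tau,z)}-\dfrac{\theta_{-(m+\frac12),m+1}(\tau,z)}{\theta_{\frac12,1}(\tau,z)}$ and of $\theta_{k,m}(\tau,z)-\theta_{-k,m}(\tau,z)$ with $k$ even, $1\le k\le m-1$. Then: 1) $V^{[m,0]}=U^{[m,0]}$ for every odd positive integer $m$; 2) $V^{[m,\frac12]}=U^{[m,\frac12]}$ for every positive integer $m$. -/

import Mathlib

namespace ThetaSpan

open Complex Filter Topology

noncomputable section

/-! ### Theta functions and the functions `Φ` -/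

/-- Jacobi's theta function
`θ_{k,m}(τ, z) = ∑ j ∈ ℤ, exp (2 π i m (j + k / 2m) z) * q ^ (m (j + k / 2m) ^ 2)`,
`q = exp (2 π i τ)`. -/
def theta (k m : ℝ) (τ z : ℂ) : ℂ :=
  ∑' j : ℤ, cexp (2 * Real.pi * I * (m * (j + k / (2 * m)) * z + m * (j + k / (2 * m)) ^ 2 * τ))

/-- `Φ₁^{[m;s]}(τ, z₁, z₂, t)`. -/
def Phi₁ (m s : ℝ) (τ z₁ z₂ t : ℂ) : ℂ :=
  cexp (-2 * Real.pi * I * m * t) *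
    ∑' j : ℤ, cexp (2 * Real.pi * I * (m * j * (z₁ + z₂) + s * z₁ + (m * j ^ 2 + s * j) * τ)) /
      (1 - cexp (2 * Real.pi * I * (z₁ + j * τ)))

/-- `Φ₂^{[m;s]}(τ, z₁, z₂, t)`. -/
def Phi₂ (m s : ℝ) (τ z₁ z₂ t : ℂ) : ℂ :=
  cexp (-2 * Real.pi * I * m * t) *
    ∑' j : ℤ, cexp (2 * Real.pi * I * (-m * j * (z₁ + z₂) - s * z₂ + (m * j ^ 2 + s * j) * τ)) /
      (1 - cexp (2 * Real.pi * I * (-z₂ + j * τ)))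

/-- `Φ^{[m;s]} = Φ₁^{[m;s]} - Φ₂^{[m;s]}`. -/
def Phi (m s : ℝ) (τ z₁ z₂ t : ℂ) : ℂ := Phi₁ m s τ z₁ z₂ t - Phi₂ m s τ z₁ z₂ t

/-! ### Functions of `(τ, z)` up to equality on a dense open set -/

/-- The filter of the sets that contain a dense open set. -/
def denseOpen (X : Type*) [TopologicalSpace X] : Filter X where
  sets := {s | ∃ u ⊆ s, IsOpen u ∧ Dense u}
  univ_sets := ⟨Set.univ, subset_rfl, isOpen_univ, dense_univ⟩
  sets_of_superset := fun ⟨u, hu, h⟩ hst => ⟨u, hu.trans hst, h⟩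
  inter_sets := fun ⟨u, hus, hu, hu'⟩ ⟨v, hvt, hv, hv'⟩ =>
    ⟨u ∩ v, Set.inter_subset_inter hus hvt, hu.inter hv, hu'.inter_of_isOpen_left hv' hu⟩

/-- Functions of `(τ, z)`, `τ` in the upper half-plane and `z ∈ ℂ`, two of which are identified if
they agree on a dense open set. The meromorphic functions embed into this ring: the
values that are assigned at poles do not matter, and two meromorphic functions are identified only
if they are equal. -/
abbrev Fun : Type := Germ (denseOpen (UpperHalfPlane × ℂ)) ℂ

/-- The class of a function of `(τ, z)`. -/
def toFun (F : ℂ → ℂ → ℂ) : Fun :=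
  Germ.ofFun (fun p : UpperHalfPlane × ℂ => F (p.1 : ℂ) p.2)

/-! ### The coefficients `ℂ[[q^{1/2}]]` and `ℂ((q^{1/2}))` -/

/-- `q ^ b` for a real exponent `b`, where `q = exp (2 π i τ)`. -/
def qpow (b : ℝ) (τ : UpperHalfPlane) : ℂ := cexp (2 * Real.pi * I * b * τ)

/-- The functions `q ^ b * ∑ j ≥ 0, a j * (q ^ (1/2)) ^ j` on the upper half-plane, with `b` real and
the series convergent for every `τ`. -/
def qSeries : Set (UpperHalfPlane → ℂ) :=
  {f | ∃ (b : ℝ) (a : ℕ → ℂ), ∀ τ : UpperHalfPlane,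
    HasSum (fun j : ℕ => a j * qpow (b + j / 2) τ) (f τ)}

theorem qpow_add (b c : ℝ) (τ : UpperHalfPlane) : qpow (b + c) τ = qpow b τ * qpow c τ := by
  unfold qpow
  rw [← Complex.exp_add]
  push_cast
  ring_nf

theorem one_mem_qSeries : (1 : UpperHalfPlane → ℂ) ∈ qSeries := by
  refine ⟨0, fun j => if j = 0 then 1 else 0, fun τ => ?_⟩
  have h := hasSum_ite_eq (0 : ℕ) (1 : ℂ)
  have e : (fun j : ℕ => (if j = 0 then (1 : ℂ) else 0) * qpow (0 + j / 2) τ) =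
      fun j : ℕ => if j = 0 then (1 : ℂ) else 0 := by
    funext j
    split_ifs with hj <;> simp [hj, qpow]
  rw [e]
  exact h

theorem mul_mem_qSeries {f g : UpperHalfPlane → ℂ} (hf : f ∈ qSeries) (hg : g ∈ qSeries) :
    f * g ∈ qSeries := by
  obtain ⟨b, a, ha⟩ := hf
  obtain ⟨b', a', ha'⟩ := hg
  refine ⟨b + b', fun n => ∑ k ∈ Finset.range (n + 1), a k * a' (n - k), fun τ => ?_⟩
  have h := hasSum_sum_range_mul_of_summable_norm (ha τ).summable.norm (ha' τ).summable.norm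
  rw [(ha τ).tsum_eq, (ha' τ).tsum_eq] at h
  suffices e : (fun n : ℕ => (∑ k ∈ Finset.range (n + 1), a k * a' (n - k)) *
      qpow (b + b' + n / 2) τ) = fun n : ℕ => ∑ k ∈ Finset.range (n + 1),
        a k * qpow (b + k / 2) τ * (a' (n - k) * qpow (b' + ((n - k : ℕ) : ℝ) / 2) τ) by
    rw [e]
    exact h
  funext n
  rw [Finset.sum_mul]
  refine Finset.sum_congr rfl fun k hk => ?_
  have hk' : k ≤ n := Nat.lt_succ_iff.1 (Finset.mem_range.1 hk)
  have e : b + b' + (n : ℝ) / 2 = (b + k / 2) + (b' + ((n - k : ℕ) : ℝ) / 2) := by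
    rw [Nat.cast_sub hk']
    ring
  rw [e, qpow_add]
  ring

/-- `ℂ[[q^{1/2}]]`, the `ℂ`-linear span of the functions `q ^ b * ∑ j ≥ 0, a j * (q ^ (1/2)) ^ j`. -/
def qInt : Subalgebra ℂ (UpperHalfPlane → ℂ) :=
  (Submodule.span ℂ qSeries).toSubalgebra (Submodule.subset_span one_mem_qSeries)
    fun f g hf hg => by
      have h := Submodule.mul_mem_mul hf hg
      rw [Submodule.span_mul_span] at h
      refine Submodule.span_mono ?_ h
      rintro _ ⟨u, hu, v, hv, rfl⟩
      exact mul_mem_qSeries hu hv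

theorem differentiableOn_of_mem_qSeries {f : UpperHalfPlane → ℂ} (hf : f ∈ qSeries) :
    DifferentiableOn ℂ (fun w => f (UpperHalfPlane.ofComplex w)) {w : ℂ | 0 < w.im} := by
  obtain ⟨b, a, ha⟩ := hf
  intro w hw
  have hw' : 0 < w.im := hw
  set c : ℝ := w.im / 2 with hc
  have hc0 : 0 < c := by positivity
  set V : Set ℂ := {v | c < v.im} with hV
  have hVo : IsOpen V := isOpen_lt continuous_const Complex.continuous_im
  have hwV : w ∈ V := by
    change c < w.im
    linarith
  have hmain : DifferentiableOn ℂ (fun v : ℂ =>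
      ∑' j : ℕ, a j * cexp (2 * Real.pi * I * ((j : ℂ) / 2) * v)) V := by
    have hs : Summable fun j : ℕ => ‖a j * cexp (2 * Real.pi * I * ((j : ℂ) / 2) * (c * I))‖ := by
      let σ : UpperHalfPlane := ⟨(c : ℂ) * I, by simpa using hc0⟩
      have h1 := ((ha σ).summable.mul_left (qpow (-b) σ)).norm
      refine h1.congr fun j => ?_
      have e : qpow (j / 2) σ = qpow (-b) σ * qpow (b + j / 2) σ := by
        rw [← qpow_add]
        ring_nf
      have e2 : qpow (j / 2) σ = cexp (2 * Real.pi * I * ((j : ℂ) / 2) * (c * I)) := by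
        simp [qpow, σ]
      rw [← e2, e]
      ring_nf
    refine differentiableOn_tsum_of_summable_norm hs (fun j => by fun_prop) hVo ?_
    intro j v hv
    rw [norm_mul, norm_mul]
    refine mul_le_mul_of_nonneg_left ?_ (norm_nonneg _)
    rw [Complex.norm_exp, Complex.norm_exp, Real.exp_le_exp]
    have hv' : c < v.im := hv
    have e1 : (2 * Real.pi * I * ((j : ℂ) / 2) * v).re = -(Real.pi * j * v.im) := by
      have : (2 * Real.pi * I * ((j : ℂ) / 2) * v) = ((Real.pi * j : ℝ) : ℂ) * (I * v) := by
        push_cast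
        ring
      rw [this, Complex.re_ofReal_mul]
      simp
    have e2 : (2 * Real.pi * I * ((j : ℂ) / 2) * (c * I)).re = -(Real.pi * j * c) := by
      have : (2 * Real.pi * I * ((j : ℂ) / 2) * (c * I)) =
          ((Real.pi * j : ℝ) : ℂ) * (I * (c * I)) := by
        push_cast
        ring
      rw [this, Complex.re_ofReal_mul]
      simp
    rw [e1, e2]
    have : 0 ≤ Real.pi * j := by positivity
    nlinarith
  have hexp : DifferentiableOn ℂ (fun v : ℂ => cexp (2 * Real.pi * I * b * v) *
      ∑' j : ℕ, a j * cexp (2 * Real.pi * I * ((j : ℂ) / 2) * v)) V :=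
    DifferentiableOn.mul (by fun_prop) hmain
  refine DifferentiableAt.differentiableWithinAt ?_
  refine ((hexp w hwV).differentiableAt (hVo.mem_nhds hwV)).congr_of_eventuallyEq ?_
  filter_upwards [hVo.mem_nhds hwV] with v hv
  have hv0 : 0 < v.im := hc0.trans hv
  rw [UpperHalfPlane.ofComplex_apply_of_im_pos hv0, ← (ha ⟨v, hv0⟩).tsum_eq, ← tsum_mul_left]
  refine tsum_congr fun j => ?_
  rw [qpow_add]
  simp only [qpow]
  push_cast
  ring

theorem differentiableOn_of_mem_qInt {f : UpperHalfPlane → ℂ} (hf : f ∈ qInt) :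
    DifferentiableOn ℂ (fun w => f (UpperHalfPlane.ofComplex w)) {w : ℂ | 0 < w.im} := by
  have hf' : f ∈ Submodule.span ℂ qSeries := hf
  induction hf' using Submodule.span_induction with
  | mem x hx => exact differentiableOn_of_mem_qSeries hx
  | zero => exact differentiableOn_const 0
  | add x y hx hy h1 h2 => exact (h1 hx).add (h2 hy)
  | smul c x hx h => exact (h hx).const_smul c

/-- A nonzero element of `ℂ[[q^{1/2}]]` is nonzero on a dense open set. -/
theorem ne_zero_of_mem_qInt {f : UpperHalfPlane → ℂ} (hf : f ∈ qInt) (h0 : f ≠ 0) :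
    IsOpen {τ | f τ ≠ 0} ∧ Dense {τ | f τ ≠ 0} := by
  have hd := differentiableOn_of_mem_qInt hf
  have ho : IsOpen {w : ℂ | 0 < w.im} := isOpen_lt continuous_const Complex.continuous_im
  have hcont : Continuous f := by
    have h := hd.continuousOn.comp_continuous UpperHalfPlane.continuous_coe
      (fun τ => UpperHalfPlane.coe_im_pos τ)
    simpa [Function.comp_def] using h
  refine ⟨isOpen_ne_fun hcont continuous_const, ?_⟩
  by_contra hnd
  apply h0
  obtain ⟨τ, hτ⟩ : ∃ τ, τ ∉ closure {τ | f τ ≠ 0} := by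
    by_contra! h
    exact hnd h
  have h1 : ∀ᶠ σ in 𝓝 τ, f σ = 0 := by
    filter_upwards [isClosed_closure.isOpen_compl.mem_nhds hτ] with σ hσ
    by_contra h
    exact hσ (subset_closure h)
  have h2 : (fun w => f (UpperHalfPlane.ofComplex w)) =ᶠ[𝓝 (τ : ℂ)] 0 := by
    rw [← UpperHalfPlane.isOpenEmbedding_coe.map_nhds_eq τ]
    simpa [EventuallyEq, Filter.eventually_map] using h1
  have hpre : IsPreconnected {w : ℂ | 0 < w.im} :=
    (convex_halfSpace_im_gt 0).isPreconnected
  have h3 := (hd.analyticOnNhd ho).eqOn_zero_of_preconnected_of_eventuallyEq_zero hpre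
    (UpperHalfPlane.coe_im_pos τ) h2
  funext σ
  simpa using h3 (UpperHalfPlane.coe_im_pos σ)

theorem mul_ne_zero_of_mem_qInt {f g : UpperHalfPlane → ℂ} (hf : f ∈ qInt) (hg : g ∈ qInt)
    (hf0 : f ≠ 0) (hg0 : g ≠ 0) : f * g ≠ 0 := by
  obtain ⟨ho, hd⟩ := ne_zero_of_mem_qInt hf hf0
  obtain ⟨_, hd'⟩ := ne_zero_of_mem_qInt hg hg0
  obtain ⟨τ, h1, h2⟩ := (hd.inter_of_isOpen_left hd' ho).nonempty
  exact fun h => mul_ne_zero h1 h2 (congrFun h τ)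

theorem eventually_ne_zero_of_mem_qInt {f : UpperHalfPlane → ℂ} (hf : f ∈ qInt) (h0 : f ≠ 0) :
    ∀ᶠ p : UpperHalfPlane × ℂ in denseOpen (UpperHalfPlane × ℂ), f p.1 ≠ 0 := by
  obtain ⟨ho, hd⟩ := ne_zero_of_mem_qInt hf h0
  exact ⟨Prod.fst ⁻¹' {τ | f τ ≠ 0}, subset_rfl, ho.preimage continuous_fst,
    hd.preimage isOpenMap_fst⟩

/-- The quotient `f / g` of two functions of `τ`, as a function of `(τ, z)`. -/
def ratio (f g : UpperHalfPlane → ℂ) : Fun :=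
  Germ.ofFun (fun p : UpperHalfPlane × ℂ => f p.1 / g p.1)

/-- `ℂ((q^{1/2}))`, the quotients `f / g` of elements `f` and `g ≠ 0` of `ℂ[[q^{1/2}]]`. -/
def qFrac : Subring Fun where
  carrier := {x | ∃ f ∈ qInt, ∃ g ∈ qInt, g ≠ 0 ∧ x = ratio f g}
  one_mem' := ⟨1, one_mem _, 1, one_mem _, one_ne_zero, by
    refine Germ.coe_eq.2 (Eventually.of_forall fun p => ?_)
    simp⟩
  zero_mem' := ⟨0, zero_mem _, 1, one_mem _, one_ne_zero, by
    refine Germ.coe_eq.2 (Eventually.of_forall fun p => ?_)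
    simp⟩
  mul_mem' := by
    rintro _ _ ⟨f, hf, g, hg, hg0, rfl⟩ ⟨f', hf', g', hg', hg0', rfl⟩
    refine ⟨f * f', mul_mem hf hf', g * g', mul_mem hg hg',
      mul_ne_zero_of_mem_qInt hg hg' hg0 hg0', ?_⟩
    refine Germ.coe_eq.2 (Eventually.of_forall fun p => ?_)
    exact div_mul_div_comm _ _ _ _
  neg_mem' := by
    rintro _ ⟨f, hf, g, hg, hg0, rfl⟩
    refine ⟨-f, neg_mem hf, g, hg, hg0, ?_⟩
    refine Germ.coe_eq.2 (Eventually.of_forall fun p => ?_)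
    exact (neg_div _ _).symm
  add_mem' := by
    rintro _ _ ⟨f, hf, g, hg, hg0, rfl⟩ ⟨f', hf', g', hg', hg0', rfl⟩
    refine ⟨f * g' + g * f', add_mem (mul_mem hf hg') (mul_mem hg hf'), g * g', mul_mem hg hg',
      mul_ne_zero_of_mem_qInt hg hg' hg0 hg0', ?_⟩
    refine Germ.coe_eq.2 ?_
    filter_upwards [eventually_ne_zero_of_mem_qInt hg hg0,
      eventually_ne_zero_of_mem_qInt hg' hg0'] with p h1 h2
    exact div_add_div _ _ h1 h2

/-! ### The spaces `V^{[m,1/2]}`, `V^{[m,0]}`, `U^{[m,1/2]}`, `U^{[m,0]}` -/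

/-- `Φ^{[m/2;s]}(2τ, z + τ/2 - 1/2, z - τ/2 + 1/2, τ/8)` as a function of `(τ, z)`. -/
def phiFun (m : ℕ) (s : ℝ) : Fun :=
  toFun fun τ z => Phi (m / 2) s (2 * τ) (z + τ / 2 - 1 / 2) (z - τ / 2 + 1 / 2) (τ / 8)

/-- `[θ_{k,m} - θ_{-k,m}](τ, z)`. -/
def thetaDiff (k m : ℕ) : Fun :=
  toFun fun τ z => theta k m τ z - theta (-k) m τ z

/-- `θ_{c,m+1}(τ, z) / θ_{-1/2,1}(τ, z) - θ_{-c,m+1}(τ, z) / θ_{1/2,1}(τ, z)`. -/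
def thetaRatio (c : ℝ) (m : ℕ) : Fun :=
  toFun fun τ z => theta c (m + 1) τ z / theta (-1 / 2) 1 τ z -
    theta (-c) (m + 1) τ z / theta (1 / 2) 1 τ z

/-- `V^{[m,1/2]}`. -/
def VHalf (m : ℕ) : Submodule qFrac Fun :=
  Submodule.span qFrac {x | ∃ s : ℝ, (∃ n : ℤ, Odd n ∧ s = n / 2) ∧
    1 / 2 ≤ s ∧ s ≤ ((m : ℝ) + 1) / 2 ∧ x = phiFun m s}

/-- `V^{[m,0]}`. -/
def VZero (m : ℕ) : Submodule qFrac Fun :=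
  Submodule.span qFrac {x | ∃ s : ℝ, (∃ n : ℤ, s = n) ∧
    1 ≤ s ∧ s ≤ ((m : ℝ) + 1) / 2 ∧ x = phiFun m s}

/-- `U^{[m,1/2]}`. -/
def UHalf (m : ℕ) : Submodule qFrac Fun :=
  Submodule.span qFrac (insert (thetaRatio (1 / 2) m)
    {x | ∃ k : ℕ, Odd k ∧ 1 ≤ k ∧ k + 1 ≤ m ∧ x = thetaDiff k m})

/-- `U^{[m,0]}`. -/
def UZero (m : ℕ) : Submodule qFrac Fun :=
  Submodule.span qFrac (insert (thetaRatio (m + 1 / 2) m)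
    {x | ∃ k : ℕ, Even k ∧ 1 ≤ k ∧ k + 1 ≤ m ∧ x = thetaDiff k m})

end

end ThetaSpan

namespace ThetaSpan

open Complex Filter Topology

noncomputable section

/-! Put `z₁ = z + τ/2 - 1/2` and `A_s(z) = ∑ j, e(m j z + s z₁ + (m j² + 2 s j) τ) / (1 - e(z₁ + 2 j
τ))`. The generators of `V` are `q^{-m/16} (A_s(z) - A_s(-z))` (`Phi_eq_appell`). Two relations link
them to the generators of `U`.

Telescoping: passing from `s` to `s + 1` multiplies the `j`-th numerator by `e(z₁ + 2 j τ)`, so `A_s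
- A_{s+1}` is a power of `q` times a constant times `θ_{2s,m}`. Taking odd parts in `z`, consecutive
generators of `V` differ by an invertible multiple of `θ_{2s,m} - θ_{-2s,m}`
(`phiFun_sub_phiFun_add_one`).

Expansion: each pole of `A_s` is a zero of `θ_{-1/2,1}`, so `P = θ_{-1/2,1} A_s` is entire; it lies
in the span of the `m + 1` functions `θ_{2s-1/2+2n,m+1}`, as do the `m` products `θ_{2(s+k),m}
θ_{-1/2,1}`, `0 ≤ k < m`. For generic `τ` these `m + 1` functions are independent, hence they span,
and `θ_{2s-1/2,m+1} / θ_{-1/2,1}` is a combination of `A_s` and the `θ_{2(s+k),m}`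
(`theta_eq_expansion`). The coefficients are recovered from values at `z = 1/2 - τ/2`, where only
`P` survives, and at `z = l/m`, by Fourier inversion. Those values are series in `q`, so the
coefficients lie in `ℂ((q^{1/2}))`; the coefficient of `A_s` is nonzero when `1/2 ≤ s ≤ (m+1)/2`.
Odd parts give `thetaRatio_eq`.

Modulo theta differences, the theta quotient in `U` can thus be exchanged for one `Φ`: the one with
`s = 1/2` for `U^{[m,1/2]}`, and the one with `s = (m+1)/2`, an integer for odd `m`, for
`U^{[m,0]}`. Telescoping supplies all others. -/

/-! ### The normalized exponential -/

/-- `exp (2 π i u)`. -/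
def ex (u : ℂ) : ℂ := cexp (2 * Real.pi * I * u)

theorem ex_add (u v : ℂ) : ex (u + v) = ex u * ex v := by
  simp only [ex, ← Complex.exp_add]
  ring_nf

theorem ex_zero : ex 0 = 1 := by simp [ex]

theorem ex_ne_zero (u : ℂ) : ex u ≠ 0 := Complex.exp_ne_zero _

theorem ex_int (n : ℤ) : ex n = 1 := by
  rw [ex, Complex.exp_eq_one_iff]
  exact ⟨n, by ring⟩

theorem ex_half : ex (1 / 2) = -1 := by
  rw [ex, show 2 * (Real.pi : ℂ) * I * (1 / 2) = Real.pi * I by ring, Complex.exp_pi_mul_I]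

theorem ex_nat_mul (n : ℕ) (u : ℂ) : ex (n * u) = ex u ^ n := by
  rw [ex, ex, ← Complex.exp_nat_mul]
  ring_nf

theorem norm_ex (u : ℂ) : ‖ex u‖ = Real.exp (-(2 * Real.pi * u.im)) := by
  rw [ex, Complex.norm_exp]
  congr 1
  have : 2 * (Real.pi : ℂ) * I * u = ((2 * Real.pi : ℝ) : ℂ) * (I * u) := by push_cast; ring
  rw [this, Complex.re_ofReal_mul]
  simp

theorem differentiable_ex : Differentiable ℂ ex := by
  unfold ex
  fun_prop

theorem continuous_ex : Continuous ex := differentiable_ex.continuous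

theorem qpow_eq_ex (b : ℝ) (τ : UpperHalfPlane) : qpow b τ = ex (b * τ) := by
  simp only [qpow, ex]
  ring_nf

/-! ### Theta functions -/

theorem ex_eq_mul_jacobiTheta₂_term (M σ : ℝ) (τ z : ℂ) (j : ℤ) :
    ex ((M * j + σ) * z + (M * j ^ 2 + 2 * σ * j) * τ) =
      ex (σ * z) * jacobiTheta₂_term j (M * z + 2 * σ * τ) (2 * M * τ) := by
  simp only [ex, jacobiTheta₂_term, ← Complex.exp_add]
  ring_nf

/-- With the index written as `2σ`, `M (j + 2σ/2M) = M j + σ`, and the power `q^{σ²/M}` that does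
not depend on `j` factors out. -/
theorem theta_eq_mul_tsum {M : ℝ} (hM : M ≠ 0) (σ : ℝ) (τ z : ℂ) :
    theta (2 * σ) M τ z = ex (σ ^ 2 / M * τ) *
      ∑' j : ℤ, ex ((M * j + σ) * z + (M * j ^ 2 + 2 * σ * j) * τ) := by
  have hM' : (M : ℂ) ≠ 0 := by exact_mod_cast hM
  rw [theta, ← tsum_mul_left]
  refine tsum_congr fun j => ?_
  rw [← ex_add, ex]
  congr 2
  push_cast
  field_simp
  ring

theorem im_two_mul_pos {M : ℝ} (hM : 0 < M) {τ : ℂ} (hτ : 0 < τ.im) : 0 < (2 * M * τ).im := by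
  have : (2 * M * τ) = ((2 * M : ℝ) : ℂ) * τ := by push_cast; ring
  rw [this, Complex.im_ofReal_mul]
  positivity

theorem theta_eq_mul_jacobiTheta₂ {M : ℝ} (hM : M ≠ 0) (σ : ℝ) (τ z : ℂ) :
    theta (2 * σ) M τ z = ex (σ ^ 2 / M * τ) *
      (ex (σ * z) * jacobiTheta₂ (M * z + 2 * σ * τ) (2 * M * τ)) := by
  rw [theta_eq_mul_tsum hM, jacobiTheta₂, ← tsum_mul_left (a := ex (σ * z))]
  simp_rw [ex_eq_mul_jacobiTheta₂_term]

theorem hasSum_theta {M : ℝ} (hM : 0 < M) (σ : ℝ) {τ : ℂ} (hτ : 0 < τ.im) (z : ℂ) :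
    HasSum (fun j : ℤ => ex ((M * j + σ) * z + (M * j ^ 2 + 2 * σ * j) * τ))
      (ex (-(σ ^ 2 / M * τ)) * theta (2 * σ) M τ z) := by
  have h : Summable fun j : ℤ => ex ((M * j + σ) * z + (M * j ^ 2 + 2 * σ * j) * τ) := by
    simp_rw [ex_eq_mul_jacobiTheta₂_term]
    exact ((summable_jacobiTheta₂_term_iff _ _).2 (im_two_mul_pos hM hτ)).mul_left _
  rw [theta_eq_mul_tsum hM.ne', ← mul_assoc, ← ex_add, neg_add_cancel, ex_zero, one_mul]
  exact h.hasSum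

theorem theta_neg_left (k m : ℝ) (τ z : ℂ) : theta (-k) m τ z = theta k m τ (-z) := by
  rw [theta, theta, ← (Equiv.neg ℤ).tsum_eq]
  refine tsum_congr fun j => ?_
  congr 1
  simp only [Equiv.neg_apply]
  push_cast
  ring

theorem theta_add_period (k : ℝ) {m : ℝ} (hm : m ≠ 0) (τ z : ℂ) :
    theta (k + 2 * m) m τ z = theta k m τ z := by
  have hm' : (m : ℂ) ≠ 0 := by exact_mod_cast hm
  symm
  rw [theta, theta, ← (Equiv.addRight (1 : ℤ)).tsum_eq]
  refine tsum_congr fun j => ?_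
  congr 1
  simp only [Equiv.coe_addRight]
  push_cast
  field_simp
  ring

theorem theta_add_int_mul_period (k : ℝ) {m : ℝ} (hm : m ≠ 0) (n : ℤ) (τ z : ℂ) :
    theta (k + n * (2 * m)) m τ z = theta k m τ z := by
  induction n using Int.induction_on with
  | zero => simp
  | succ n ih =>
    rw [← ih, ← theta_add_period (k + ((n : ℤ) : ℝ) * (2 * m)) hm]
    push_cast
    ring_nf
  | pred n ih =>
    rw [← ih, ← theta_add_period _ hm]
    push_cast
    ring_nf

theorem continuous_theta (k : ℝ) {m : ℝ} (hm : 0 < m) :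
    Continuous fun p : UpperHalfPlane × ℂ => theta k m p.1 p.2 := by
  obtain ⟨σ, rfl⟩ : ∃ σ, k = 2 * σ := ⟨k / 2, by ring⟩
  simp_rw [theta_eq_mul_jacobiTheta₂ hm.ne']
  have hc : Continuous fun p : UpperHalfPlane × ℂ => (p.1 : ℂ) :=
    UpperHalfPlane.continuous_coe.comp continuous_fst
  refine (continuous_ex.comp (by fun_prop)).mul ((continuous_ex.comp (by fun_prop)).mul ?_)
  rw [continuous_iff_continuousAt]
  intro p
  have h := continuousAt_jacobiTheta₂ (m * p.2 + 2 * σ * p.1)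
    (im_two_mul_pos hm (UpperHalfPlane.coe_im_pos p.1))
  exact ContinuousAt.comp (f := fun p : UpperHalfPlane × ℂ =>
    ((m * p.2 + 2 * σ * p.1 : ℂ), (2 * m * p.1 : ℂ))) h (by fun_prop)

theorem differentiable_theta (k : ℝ) {m : ℝ} (hm : 0 < m) {τ : ℂ} (hτ : 0 < τ.im) :
    Differentiable ℂ (theta k m τ) := by
  obtain ⟨σ, rfl⟩ : ∃ σ, k = 2 * σ := ⟨k / 2, by ring⟩
  have e : theta (2 * σ) m τ = fun z => ex (σ ^ 2 / m * τ) *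
      (ex (σ * z) * jacobiTheta₂ (m * z + 2 * σ * τ) (2 * m * τ)) :=
    funext fun z => theta_eq_mul_jacobiTheta₂ hm.ne' σ τ z
  rw [e]
  intro z
  have h1 : DifferentiableAt ℂ (fun z => jacobiTheta₂ (m * z + 2 * σ * τ) (2 * m * τ)) z :=
    (differentiableAt_jacobiTheta₂_fst _ (im_two_mul_pos hm hτ)).comp
      (f := fun z : ℂ => (m * z + 2 * σ * τ : ℂ)) z (by fun_prop)
  have h2 : DifferentiableAt ℂ (fun z => ex (σ * z)) z :=
    (differentiable_ex _).comp (f := fun z : ℂ => (σ * z : ℂ)) z (by fun_prop)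
  exact (h2.mul h1).const_mul _

/-- If `θ_{k,m}(τ, a) ≠ 0` for generic `τ`, then `θ_{k,m}(τ, z) ≠ 0` for generic `(τ, z)`. -/
theorem eventually_theta_ne_zero (k : ℝ) {m : ℝ} (hm : 0 < m) (a : ℂ)
    (h : Dense {τ : UpperHalfPlane | theta k m τ a ≠ 0}) :
    ∀ᶠ p : UpperHalfPlane × ℂ in denseOpen (UpperHalfPlane × ℂ), theta k m p.1 p.2 ≠ 0 := by
  refine ⟨_, subset_rfl, isOpen_ne_fun (continuous_theta k hm) continuous_const, ?_⟩
  rw [dense_iff_inter_open]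
  rintro U hU ⟨⟨τ₁, z₁⟩, hU₁⟩
  obtain ⟨A, B, hA, hB, hτA, hzB, hAB⟩ := isOpen_prod_iff.1 hU τ₁ z₁ hU₁
  obtain ⟨τ, hτ, hτ0⟩ := dense_iff_inter_open.1 h A hA ⟨τ₁, hτA⟩
  by_contra hne
  apply hτ0
  have hz : theta k m τ =ᶠ[𝓝 z₁] 0 := by
    filter_upwards [hB.mem_nhds hzB] with z hz
    by_contra h0
    exact hne ⟨(τ, z), hAB ⟨hτ, hz⟩, h0⟩
  -- Identity theorem in `z` for this fixed `τ`: vanishing near `z₁` forces vanishing at `a`.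
  have han : AnalyticOnNhd ℂ (theta k m τ) Set.univ :=
    (differentiable_theta k hm τ.coe_im_pos).differentiableOn.analyticOnNhd isOpen_univ
  exact han.eqOn_zero_of_preconnected_of_eventuallyEq_zero isPreconnected_univ (Set.mem_univ z₁)
    hz (Set.mem_univ a)

/-! ### Families of powers of `q` -/

/-- Terms with equal exponent are collected: the coefficient of `q^{b+j/2}` is the sum of `a` over
the fibre of `n` above `j`. -/
theorem tsum_mem_qInt {ι : Type*} (a : ι → ℂ) (β : ι → ℝ) (b : ℝ) (n : ι → ℕ)
    (hβ : ∀ i, β i = b + n i / 2)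
    (hs : ∀ τ : UpperHalfPlane, Summable fun i => a i * ex (β i * τ)) :
    (fun τ : UpperHalfPlane => ∑' i, a i * ex (β i * τ)) ∈ qInt := by
  refine Submodule.subset_span ⟨b, fun j => ∑' i : {i // n i = j}, a i, fun τ => ?_⟩
  have h := (Equiv.sigmaFiberEquiv n).hasSum_iff.2 (hs τ).hasSum
  refine h.sigma fun j => ?_
  have e : (fun i : {i // n i = j} => a i * ex (β i * τ)) =
      fun i : {i // n i = j} => a i * qpow (b + j / 2) τ := by
    funext i
    rw [hβ, i.2, qpow_eq_ex]
  have hsub : Summable fun i : {i // n i = j} => a i * ex (β i * τ) :=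
    (hs τ).comp_injective Subtype.val_injective
  have h1 := hsub.hasSum
  rw [e, tsum_mul_right] at h1
  change HasSum (fun i : {i // n i = j} => a i * ex (β i * τ)) _
  rw [e]
  exact h1

/-- Divide by the lowest power of `q` and let `τ = i y`, `y → ∞`: by dominated convergence, with the
terms at `y = 1` as majorant, the sum tends to `a i₀`. -/
theorem tsum_ne_zero_of_unique_min {ι : Type*} (a : ι → ℂ) (β : ι → ℝ) (i₀ : ι) (h₀ : a i₀ ≠ 0)
    (hmin : ∀ i, i ≠ i₀ → β i₀ < β i)
    (hs : ∀ τ : UpperHalfPlane, Summable fun i => a i * ex (β i * τ)) :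
    (fun τ : UpperHalfPlane => ∑' i, a i * ex (β i * τ)) ≠ 0 := by
  classical
  intro h
  have key : ∀ y : ℝ, 0 < y → ∑' i, a i * ex ((β i - β i₀) * (y * I)) = 0 := by
    intro y hy
    have h1 := congrFun h ⟨y * I, by simpa using hy⟩
    simp only [Pi.zero_apply] at h1
    have e : ∀ i, a i * ex ((β i - β i₀) * (y * I)) =
        a i * ex (β i * (y * I)) * ex (-(β i₀ * (y * I))) := by
      intro i
      rw [mul_assoc, ← ex_add]
      ring_nf
    simp_rw [e]
    rw [tsum_mul_right, h1, zero_mul]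
  have hnorm : ∀ (y : ℝ) (i : ι), ‖a i * ex ((β i - β i₀) * (y * I))‖ =
      ‖a i‖ * Real.exp (-(2 * Real.pi * ((β i - β i₀) * y))) := by
    intro y i
    rw [norm_mul, norm_ex]
    congr 4
    rw [← Complex.ofReal_sub, Complex.im_ofReal_mul]
    simp
  have hbase : Summable fun i => ‖a i * ex ((β i - β i₀) * ((1 : ℝ) * I))‖ := by
    have h1 := ((hs ⟨(1 : ℝ) * I, by simp⟩).mul_right (ex (-(β i₀ * ((1 : ℝ) * I))))).norm
    refine h1.congr fun i => ?_
    rw [mul_assoc, ← ex_add]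
    congr 3
    change (β i : ℂ) * (((1 : ℝ) : ℂ) * I) + _ = _
    ring
  have hlim : Tendsto (fun y : ℝ => ∑' i, a i * ex ((β i - β i₀) * (y * I))) atTop
      (𝓝 (∑' i, if i = i₀ then a i₀ else 0)) := by
    refine tendsto_tsum_of_dominated_convergence hbase (fun i => ?_) ?_
    · split_ifs with hi
      · subst hi
        simp [ex_zero]
      · rw [tendsto_zero_iff_norm_tendsto_zero]
        simp_rw [hnorm]
        rw [← mul_zero ‖a i‖]
        refine Tendsto.const_mul _ (Real.tendsto_exp_atBot.comp ?_)
        have hc : 0 < 2 * Real.pi * (β i - β i₀) := by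
          have := hmin i hi
          have : 0 < β i - β i₀ := by linarith
          positivity
        refine tendsto_neg_atTop_atBot.comp ?_
        simp_rw [← mul_assoc]
        exact tendsto_id.const_mul_atTop hc
    · filter_upwards [eventually_ge_atTop 1] with y hy i
      rw [hnorm, hnorm]
      refine mul_le_mul_of_nonneg_left (Real.exp_le_exp.2 ?_) (norm_nonneg _)
      have hb : 0 ≤ β i - β i₀ := by
        by_cases hi : i = i₀
        · simp [hi]
        · linarith [hmin i hi]
      have : 0 ≤ 2 * Real.pi * (β i - β i₀) := by positivity
      nlinarith
  rw [tsum_ite_eq] at hlim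
  refine h₀ (tendsto_nhds_unique hlim ?_)
  refine tendsto_const_nhds.congr' ?_
  filter_upwards [eventually_gt_atTop 0] with y hy
  exact (key y hy).symm

/-! ### Values of theta functions as series in `q` -/

theorem theta_eq_tsum_qpow {M : ℝ} (hM : M ≠ 0) (σ a b : ℝ) (τ : ℂ) :
    theta (2 * σ) M τ (a + b * τ) = ∑' j : ℤ, ex ((M * j + σ) * a) *
      ex (((σ ^ 2 / M + σ * b + (M * j ^ 2 + (2 * σ + M * b) * j) : ℝ) : ℂ) * τ) := by
  rw [theta_eq_mul_tsum hM, ← tsum_mul_left]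
  refine tsum_congr fun j => ?_
  rw [← ex_add, ← ex_add]
  congr 1
  push_cast
  ring

theorem summable_theta_qpow {M : ℝ} (hM : 0 < M) (σ a b : ℝ) {τ : ℂ} (hτ : 0 < τ.im) :
    Summable fun j : ℤ => ex ((M * j + σ) * a) *
      ex (((σ ^ 2 / M + σ * b + (M * j ^ 2 + (2 * σ + M * b) * j) : ℝ) : ℂ) * τ) := by
  refine ((hasSum_theta hM σ hτ (a + b * τ)).summable.mul_left (ex (σ ^ 2 / M * τ))).congr
    fun j => ?_
  rw [← ex_add, ← ex_add]
  congr 1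
  push_cast
  ring

theorem theta_mem_qInt {M : ℝ} {N : ℕ} (hMN : M = N) (hN : 0 < N) (σ a b : ℝ) (C : ℤ)
    (hC : 2 * (2 * σ + M * b) = C) :
    (fun τ : UpperHalfPlane => theta (2 * σ) M τ (a + b * τ)) ∈ qInt := by
  have hM : 0 < M := by rw [hMN]; exact_mod_cast hN
  simp_rw [theta_eq_tsum_qpow hM.ne']
  -- Twice the part of the exponent depending on `j` is the integer `2 N j² + C j`; adding `C²`
  -- makes it nonnegative, and the base exponent compensates.
  refine tsum_mem_qInt _ _ (σ ^ 2 / M + σ * b - C ^ 2 / 2)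
    (fun j => (2 * N * j ^ 2 + C * j + C ^ 2).toNat) (fun j => ?_)
    fun τ => summable_theta_qpow hM σ a b τ.coe_im_pos
  have h0 : 0 ≤ 2 * N * j ^ 2 + C * j + C ^ 2 := by
    have : (1 : ℤ) ≤ N := by exact_mod_cast hN
    nlinarith [sq_nonneg (j + C), sq_nonneg j, sq_nonneg C]
  have h1 : (((2 * N * j ^ 2 + C * j + C ^ 2).toNat : ℤ) : ℝ) =
      ((2 * N * j ^ 2 + C * j + C ^ 2 : ℤ) : ℝ) := by rw [Int.toNat_of_nonneg h0]
  rw [Int.cast_natCast] at h1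
  rw [h1]
  push_cast
  rw [← hC, hMN]
  ring

/-- The bound says that `M j² + (2σ + M b) j` is positive for every integer `j ≠ 0`, so `j = 0`
carries the unique lowest power of `q`. -/
theorem theta_ne_zero {M : ℝ} (hM : 0 < M) (σ a b : ℝ) (h : |2 * σ + M * b| < M) :
    (fun τ : UpperHalfPlane => theta (2 * σ) M τ (a + b * τ)) ≠ 0 := by
  simp_rw [theta_eq_tsum_qpow hM.ne']
  refine tsum_ne_zero_of_unique_min _ _ 0 (ex_ne_zero _) (fun j hj => ?_)
    fun τ => summable_theta_qpow hM σ a b τ.coe_im_pos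
  have h1 : (1 : ℝ) ≤ |(j : ℝ)| := by exact_mod_cast Int.one_le_abs hj
  have h2 : |2 * σ + M * b| * |(j : ℝ)| < M * |(j : ℝ)| := by
    apply mul_lt_mul_of_pos_right h; linarith
  have h3 : M * |(j : ℝ)| ≤ M * |(j : ℝ)| ^ 2 := by
    apply mul_le_mul_of_nonneg_left _ hM.le; nlinarith
  rw [sq_abs] at h3
  have h4 := neg_abs_le ((2 * σ + M * b) * j)
  rw [abs_mul] at h4
  push_cast
  nlinarith

/-- At `τ = i` all terms are positive reals. This also covers the indices for which two terms share
the lowest exponent, where a leading-term argument on single terms does not apply. -/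
theorem theta_zero_ne_zero {M : ℝ} (hM : 0 < M) (σ : ℝ) :
    (fun τ : UpperHalfPlane => theta (2 * σ) M τ 0) ≠ 0 := by
  intro h
  have h1 := congrFun h UpperHalfPlane.I
  have h2 := hasSum_theta hM σ (τ := I) (by simp) 0
  simp only [UpperHalfPlane.coe_I, Pi.zero_apply] at h1
  rw [h1, mul_zero] at h2
  have e : ∀ j : ℤ, ex ((M * j + σ) * 0 + (M * j ^ 2 + 2 * σ * j) * I) =
      ((Real.exp (-(2 * Real.pi * (M * j ^ 2 + 2 * σ * j))) : ℝ) : ℂ) := by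
    intro j
    rw [ex, Complex.ofReal_exp]
    congr 1
    push_cast
    linear_combination (2 * Real.pi * (M * j ^ 2 + 2 * σ * j)) * I_mul_I
  simp_rw [e] at h2
  rw [← Complex.ofReal_zero, Complex.hasSum_ofReal] at h2
  have h3 := (hasSum_zero_iff_of_nonneg fun j => (Real.exp_pos _).le).1 h2
  exact (Real.exp_pos _).ne' (congrFun h3 0)

theorem hasSum_of_eq {ι : Type*} {f g : ι → ℂ} {a b : ℂ} (h : HasSum f a) (hf : ∀ i, g i = f i)
    (hab : b = a) : HasSum g b := by
  rw [hab, funext hf]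
  exact h

theorem ex_add_int (u : ℂ) (n : ℤ) : ex (u + n) = ex u := by
  rw [ex_add, ex_int, mul_one]

/-! ### The denominator `θ_{-1/2,1}` and its division by a linear factor -/

/-- `θ_{-1/2,1}(τ, z)`. -/
def den (τ z : ℂ) : ℂ := theta (-1 / 2) 1 τ z

theorem den_eq (τ z : ℂ) : den τ z = theta (2 * (1 / 4)) 1 τ (-z) := by
  rw [den, ← theta_neg_left]
  norm_num

theorem hasSum_den {τ : ℂ} (hτ : 0 < τ.im) (z : ℂ) :
    HasSum (fun ν : ℤ => ex (-(ν + 1 / 4) * z + (ν + 1 / 4) ^ 2 * τ)) (den τ z) := by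
  have h := (hasSum_theta one_pos (1 / 4) hτ (-z)).mul_left (ex ((1 / 4) ^ 2 * τ))
  rw [← den_eq, ← mul_assoc, ← ex_add] at h
  refine hasSum_of_eq h (fun ν => ?_) ?_
  · rw [← ex_add]
    congr 1
    push_cast
    ring
  · push_cast
    rw [show ((1 / 4) ^ 2 * τ + -((1 / 4) ^ 2 / 1 * τ) : ℂ) = 0 by ring, ex_zero, one_mul]

theorem den_eq_mul_den_add {τ : ℂ} (hτ : 0 < τ.im) (z : ℂ) (j : ℤ) :
    den τ z = ex (j * z + j ^ 2 * τ) * den τ (z + 2 * j * τ) := by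
  have h := (hasSum_den hτ (z + 2 * j * τ)).mul_left (ex (j * z + j ^ 2 * τ))
  have h' := (Equiv.subRight j).hasSum_iff.2 (hasSum_den hτ z)
  refine h'.unique (hasSum_of_eq h (fun ν => ?_) rfl)
  rw [← ex_add, Function.comp_apply, Equiv.subRight_apply]
  congr 1
  push_cast
  ring

/-- The index set of the pairs `(i, l)` with `|l| ≤ i`, where `l = a - i`. -/
abbrev QuotIndex : Type := Σ i : ℕ, Fin (2 * i + 1)

/-- The terms of the quotient of `θ_{-1/2,1}(τ, w)` by `1 - exp (2 π i (w + τ / 2 - 1 / 2))`. -/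
def quotTerm (τ w : ℂ) (x : QuotIndex) : ℂ :=
  (-1) ^ x.1 * ex (((x.2 : ℕ) - x.1 - 1 / 4) * (w + τ / 2 - 1 / 2) +
    ((x.1 + 1 / 2) ^ 2 - 1 / 16) * τ - 1 / 8)

/-- The terms `ν = i` and `ν = -(i + 1)` of `θ_{-1/2,1}` are `c` and `-c y^{2i+1}`, so `1 - y`
divides their sum with a geometric quotient of `2i + 1` terms. This makes the division explicit,
term by term. -/
theorem den_pair_eq (τ w : ℂ) (i : ℕ) :
    ex (-(((i : ℤ) : ℂ) + 1 / 4) * w + (((i : ℤ) : ℂ) + 1 / 4) ^ 2 * τ) +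
      ex (-(((-((i : ℤ) + 1) : ℤ) : ℂ) + 1 / 4) * w + (((-((i : ℤ) + 1) : ℤ) : ℂ) + 1 / 4) ^ 2 * τ) =
      (1 - ex (w + τ / 2 - 1 / 2)) * ∑ a : Fin (2 * i + 1), quotTerm τ w ⟨i, a⟩ := by
  set y := ex (w + τ / 2 - 1 / 2) with hy
  set c := (-1) ^ i * ex ((-i - 1 / 4) * (w + τ / 2 - 1 / 2) +
    ((i + 1 / 2) ^ 2 - 1 / 16) * τ - 1 / 8) with hc
  have hsign : ((-1 : ℂ)) ^ i = ex (i * (1 / 2)) := by rw [ex_nat_mul, ex_half]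
  have h1 : ∀ a : Fin (2 * i + 1), quotTerm τ w ⟨i, a⟩ = c * y ^ (a : ℕ) := by
    intro a
    rw [quotTerm, hc, hy, ← ex_nat_mul, mul_assoc, ← ex_add]
    ring_nf
  have h2 : ex (-(((i : ℤ) : ℂ) + 1 / 4) * w + (((i : ℤ) : ℂ) + 1 / 4) ^ 2 * τ) = c := by
    rw [hc, hsign, ← ex_add, ← ex_add_int _ i]
    congr 1
    push_cast
    ring
  have h3 : ex (-(((-((i : ℤ) + 1) : ℤ) : ℂ) + 1 / 4) * w +
      (((-((i : ℤ) + 1) : ℤ) : ℂ) + 1 / 4) ^ 2 * τ) = - c * y ^ (2 * i + 1) := by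
    have hneg : - c = ex (1 / 2) * c := by rw [ex_half]; ring
    rw [hneg, hc, hsign, hy, ← ex_nat_mul, ← ex_add, ← ex_add, ← ex_add]
    congr 1
    push_cast
    ring
  simp_rw [h1]
  rw [h2, h3, ← Finset.mul_sum, Fin.sum_univ_eq_sum_range (fun a => y ^ a) (2 * i + 1),
    mul_left_comm, mul_neg_geom_sum]
  ring

/-! ### Absolute convergence of the expanded product -/

theorem summable_exp_neg_mul_sq {c : ℝ} (hc : 0 < c) :
    Summable fun j : ℤ => Real.exp (-(c * j ^ 2)) := by
  have hp := Real.pi_pos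
  have h := (hasSum_theta one_pos 0 (τ := (c / (2 * Real.pi) : ℝ) * I)
    (by rw [Complex.im_ofReal_mul, I_im]; positivity) 0).summable.norm
  refine h.congr fun j => ?_
  rw [norm_ex]
  congr 2
  have : ((1 : ℝ) * j + (0 : ℝ)) * 0 + ((1 : ℝ) * j ^ 2 + 2 * (0 : ℝ) * j) *
      (((c / (2 * Real.pi) : ℝ) : ℂ) * I) = ((j ^ 2 * (c / (2 * Real.pi)) : ℝ) : ℂ) * I := by
    push_cast
    ring
  rw [this, Complex.im_ofReal_mul, I_im]
  field_simp

/-- The terms of the product of `θ_{-1/2,1}` and `∑ j, e(m j z + s z₁ + (m j² + 2 s j) τ) /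
(1 - e(z₁ + 2 j τ))`, where `z₁ = z + τ / 2 - 1 / 2`. -/
def prodTerm (m s : ℝ) (τ z : ℂ) (p : ℤ × QuotIndex) : ℂ :=
  ex ((m + 1) * p.1 * z + s * (z + τ / 2 - 1 / 2) + ((m + 1) * p.1 ^ 2 + 2 * s * p.1) * τ) *
    quotTerm τ (z + 2 * p.1 * τ) p.2

theorem prodTerm_eq (m s : ℝ) (τ z : ℂ) (j : ℤ) (x : QuotIndex) :
    prodTerm m s τ z (j, x) = (-1) ^ x.1 * ex ((m + 1) * j * z +
      (s - 1 / 4 + (x.2 : ℕ) - x.1) * (z + τ / 2 - 1 / 2) +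
      ((m + 1) * j ^ 2 + 2 * (s - 1 / 4 + (x.2 : ℕ) - x.1) * j +
        ((x.1 + 1 / 2) ^ 2 - 1 / 16)) * τ - 1 / 8) := by
  rw [prodTerm, quotTerm, mul_left_comm, ← ex_add]
  congr 2
  ring

/-- For `m ≥ 1` and `l² ≤ i²` the form `(m+1) j² + 2 l j + i²` is at least `(j² + i² + l²)/6`,
because `11 j² + 12 j l + 4 l² = (3j + 2l)² + 2 j²`. Half of this bound is kept; the other half
absorbs the linear terms `B j` and `C l` by completing squares, which determines `K`. -/
theorem exponent_lower_bound {m t : ℝ} (hm : 1 ≤ m) (ht : 0 < t) (s y : ℝ) :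
    ∃ K : ℝ, ∀ j i l : ℝ, 0 ≤ i → l ^ 2 ≤ i ^ 2 →
      t / 12 * (j ^ 2 + i ^ 2 + l ^ 2) - K ≤ (m + 1) * j * y + (s - 1 / 4 + l) * (y + t / 2) +
        ((m + 1) * j ^ 2 + 2 * (s - 1 / 4 + l) * j + ((i + 1 / 2) ^ 2 - 1 / 16)) * t := by
  set B := (m + 1) * y + 2 * (s - 1 / 4) * t
  set C := y + t / 2
  refine ⟨3 * B ^ 2 / t + 3 * C ^ 2 / t - (s - 1 / 4) * C - 3 / 16 * t, fun j i l hi hl => ?_⟩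
  have h1 : 0 ≤ t / 12 * (j + 6 * B / t) ^ 2 := by positivity
  have h2 : 0 ≤ t / 12 * (l + 6 * C / t) ^ 2 := by positivity
  have e1 : t / 12 * (j + 6 * B / t) ^ 2 = t / 12 * j ^ 2 + B * j + 3 * B ^ 2 / t := by
    field_simp
    ring
  have e2 : t / 12 * (l + 6 * C / t) ^ 2 = t / 12 * l ^ 2 + C * l + 3 * C ^ 2 / t := by
    field_simp
    ring
  have h3 : 0 ≤ t * ((m + 1) * j ^ 2 + 2 * l * j + i ^ 2 - (j ^ 2 + i ^ 2 + l ^ 2) / 6) := by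
    refine mul_nonneg ht.le ?_
    nlinarith [sq_nonneg (3 * j + 2 * l), mul_nonneg (sub_nonneg.2 hm) (sq_nonneg j)]
  have h4 : 0 ≤ i * t := by positivity
  have h5 : 0 ≤ t / 12 * i ^ 2 := by positivity
  simp only [B, C] at *
  nlinarith

theorem summable_prodTerm {m : ℝ} (hm : 1 ≤ m) (s : ℝ) {τ : ℂ} (hτ : 0 < τ.im) (z : ℂ) :
    Summable (prodTerm m s τ z) := by
  obtain ⟨K, hK⟩ := exponent_lower_bound hm hτ s z.im
  set c := 2 * Real.pi * (τ.im / 12) with hc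
  have hc0 : 0 < c := by positivity
  have hg := summable_exp_neg_mul_sq hc0
  have h3 := (hg.mul_of_nonneg (hg.mul_of_nonneg hg (fun _ => (Real.exp_pos _).le)
    (fun _ => (Real.exp_pos _).le)) (fun _ => (Real.exp_pos _).le)
    (fun _ => mul_nonneg (Real.exp_pos _).le (Real.exp_pos _).le)).mul_left
    (Real.exp (2 * Real.pi * K))
  -- The triples `(j, i, l)` with `l = a - i` embed the index set into `ℤ³`, where a product of
  -- three Gaussians is the majorant.
  have hinj : Function.Injective fun p : ℤ × QuotIndex =>
      ((p.1, ((p.2.1 : ℤ), ((p.2.2 : ℕ) : ℤ) - p.2.1)) : ℤ × ℤ × ℤ) := by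
    rintro ⟨j, i, a⟩ ⟨j', i', a'⟩ h
    simp only [Prod.mk.injEq] at h
    obtain ⟨rfl, h1, h2⟩ := h
    obtain rfl : i = i' := by exact_mod_cast h1
    have : a = a' := by
      ext
      omega
    rw [this]
  refine Summable.of_norm_bounded (h3.comp_injective hinj) ?_
  rintro ⟨j, i, a⟩
  rw [prodTerm_eq, norm_mul, norm_pow, norm_neg, norm_one, one_pow, one_mul, norm_ex]
  simp only [Function.comp_apply]
  rw [← Real.exp_add, ← Real.exp_add, ← Real.exp_add, Real.exp_le_exp]
  have ha : ((a : ℕ) : ℝ) ≤ 2 * i := by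
    have := a.2
    exact_mod_cast Nat.lt_succ_iff.1 this
  have ha0 : (0 : ℝ) ≤ ((a : ℕ) : ℝ) := by positivity
  have h := hK j i ((a : ℕ) - i) (by positivity) (by nlinarith)
  have him : ((m + 1) * j * z + (s - 1 / 4 + (a : ℕ) - i) * (z + τ / 2 - 1 / 2) +
      ((m + 1) * j ^ 2 + 2 * (s - 1 / 4 + (a : ℕ) - i) * j +
        ((i + 1 / 2) ^ 2 - 1 / 16)) * τ - 1 / 8 : ℂ).im =
      (m + 1) * j * z.im + (s - 1 / 4 + ((a : ℕ) - i)) * (z.im + τ.im / 2) +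
        ((m + 1) * j ^ 2 + 2 * (s - 1 / 4 + ((a : ℕ) - i)) * j +
          ((i + 1 / 2) ^ 2 - 1 / 16)) * τ.im := by
    have e : ((m + 1) * j * z + (s - 1 / 4 + (a : ℕ) - i) * (z + τ / 2 - 1 / 2) +
      ((m + 1) * j ^ 2 + 2 * (s - 1 / 4 + (a : ℕ) - i) * j +
        ((i + 1 / 2) ^ 2 - 1 / 16)) * τ - 1 / 8 : ℂ) =
        (((m + 1) * j : ℝ) : ℂ) * z + ((s - 1 / 4 + ((a : ℕ) - i) : ℝ) : ℂ) * z +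
        (((s - 1 / 4 + ((a : ℕ) - i)) / 2 + ((m + 1) * j ^ 2 + 2 * (s - 1 / 4 + ((a : ℕ) - i)) * j +
          ((i + 1 / 2) ^ 2 - 1 / 16)) : ℝ) : ℂ) * τ +
        ((-(s - 1 / 4 + ((a : ℕ) - i)) / 2 - 1 / 8 : ℝ) : ℂ) := by
      push_cast
      ring
    rw [e]
    simp only [Complex.add_im, Complex.im_ofReal_mul, Complex.ofReal_im]
    ring
  rw [him]
  have hp : 0 ≤ 2 * Real.pi := by positivity
  have h' := mul_le_mul_of_nonneg_left h hp
  rw [hc]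
  push_cast
  linarith

theorem summable_quotTerm {τ : ℂ} (hτ : 0 < τ.im) (w : ℂ) : Summable (quotTerm τ w) := by
  have h := (summable_prodTerm le_rfl 0 hτ w).comp_injective
    (i := fun x : QuotIndex => ((0 : ℤ), x)) (fun x y h => (Prod.mk.inj h).2)
  refine h.congr fun x => ?_
  simp [prodTerm, ex_zero]

theorem den_eq_mul_tsum {τ : ℂ} (hτ : 0 < τ.im) (w : ℂ) :
    den τ w = (1 - ex (w + τ / 2 - 1 / 2)) * ∑' x, quotTerm τ w x := by
  have h1 := (summable_quotTerm hτ w).hasSum.sigma fun i => hasSum_fintype _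
  have h2 := (hasSum_den hτ w).nat_add_neg_add_one
  exact h2.unique (hasSum_of_eq (h1.mul_left (1 - ex (w + τ / 2 - 1 / 2)))
    (fun i => den_pair_eq τ w i) rfl)

/-! ### The Appell function `∑ j, e(m j z + s z₁ + (m j² + 2 s j) τ) / (1 - e(z₁ + 2 j τ))` -/

/-- The terms of the Appell function with `z₁ = z + τ / 2 - 1 / 2`. -/
def appellTerm (m s : ℝ) (τ z : ℂ) (j : ℤ) : ℂ :=
  ex (m * j * z + s * (z + τ / 2 - 1 / 2) + (m * j ^ 2 + 2 * s * j) * τ) /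
    (1 - ex (z + τ / 2 - 1 / 2 + 2 * j * τ))

/-- The Appell function. -/
def appell (m s : ℝ) (τ z : ℂ) : ℂ := ∑' j : ℤ, appellTerm m s τ z j

/-- The holomorphic extension of the product of `θ_{-1/2,1}` and the Appell function. -/
def prodSum (m s : ℝ) (τ z : ℂ) : ℂ := ∑' p, prodTerm m s τ z p

theorem hasSum_prodSum_fst {m : ℝ} (hm : 1 ≤ m) (s : ℝ) {τ : ℂ} (hτ : 0 < τ.im) (z : ℂ) :
    HasSum (fun j : ℤ => ex ((m + 1) * j * z + s * (z + τ / 2 - 1 / 2) +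
      ((m + 1) * j ^ 2 + 2 * s * j) * τ) * ∑' x, quotTerm τ (z + 2 * j * τ) x)
      (prodSum m s τ z) :=
  (summable_prodTerm hm s hτ z).hasSum.prod_fiberwise fun j =>
    (summable_quotTerm hτ (z + 2 * j * τ)).hasSum.mul_left _

theorem den_eq_mul_tsum_shift {τ : ℂ} (hτ : 0 < τ.im) (z : ℂ) (j : ℤ) :
    den τ z = ex (j * z + j ^ 2 * τ) * ((1 - ex (z + τ / 2 - 1 / 2 + 2 * j * τ)) *
      ∑' x, quotTerm τ (z + 2 * j * τ) x) := by
  rw [den_eq_mul_den_add hτ z j, den_eq_mul_tsum hτ (z + 2 * j * τ),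
    show z + 2 * j * τ + τ / 2 - 1 / 2 = z + τ / 2 - 1 / 2 + 2 * j * τ by ring]

theorem one_sub_ex_ne_zero {τ : ℂ} (hτ : 0 < τ.im) {z : ℂ} (hz : den τ z ≠ 0) (j : ℤ) :
    1 - ex (z + τ / 2 - 1 / 2 + 2 * j * τ) ≠ 0 := by
  intro h
  apply hz
  rw [den_eq_mul_tsum_shift hτ z j, h, zero_mul, mul_zero]

/-- Quasi-periodicity moves the division of `θ_{-1/2,1}` by `1 - e(z₁)` to each factor `1 - e(z₁ + 2
j τ)`, so every Appell term times `θ_{-1/2,1}` is a row of `prodTerm`. -/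
theorem hasSum_appell {m : ℝ} (hm : 1 ≤ m) (s : ℝ) {τ : ℂ} (hτ : 0 < τ.im) {z : ℂ}
    (hz : den τ z ≠ 0) : HasSum (appellTerm m s τ z) (prodSum m s τ z / den τ z) := by
  refine hasSum_of_eq ((hasSum_prodSum_fst hm s hτ z).div_const (den τ z)) (fun j => ?_) rfl
  have h1 := den_eq_mul_tsum_shift hτ z j
  have h2 := one_sub_ex_ne_zero hτ hz j
  rw [appellTerm, div_eq_div_iff h2 hz, h1,
    show (((m : ℂ) + 1) * j * z + s * (z + τ / 2 - 1 / 2) + ((m + 1) * j ^ 2 + 2 * s * j) * τ) =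
      (m * j * z + s * (z + τ / 2 - 1 / 2) + (m * j ^ 2 + 2 * s * j) * τ) +
        (j * z + j ^ 2 * τ) by ring, ex_add _ (j * z + j ^ 2 * τ)]
  ring

theorem appell_sub_appell_add_one {m : ℝ} (hm : 1 ≤ m) (s : ℝ) {τ : ℂ} (hτ : 0 < τ.im) {z : ℂ}
    (hz : den τ z ≠ 0) : appell m s τ z - appell m (s + 1) τ z =
      ex (s * (τ / 2 - 1 / 2) - s ^ 2 / m * τ) * theta (2 * s) m τ z := by
  have h := (hasSum_appell hm s hτ hz).sub (hasSum_appell hm (s + 1) hτ hz)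
  rw [appell, appell, (hasSum_appell hm s hτ hz).tsum_eq, (hasSum_appell hm (s + 1) hτ hz).tsum_eq]
  have h' := (hasSum_theta (by linarith : 0 < m) s hτ z).mul_left (ex (s * (τ / 2 - 1 / 2)))
  refine h.unique (hasSum_of_eq h' (fun j => ?_) ?_)
  · have h2 := one_sub_ex_ne_zero hτ hz j
    rw [appellTerm, appellTerm, ← sub_div, div_eq_iff h2, ← ex_add]
    have e1 : ex (m * j * z + ((s + 1 : ℝ) : ℂ) * (z + τ / 2 - 1 / 2) +
        (m * j ^ 2 + 2 * ((s + 1 : ℝ) : ℂ) * j) * τ) =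
        ex (m * j * z + s * (z + τ / 2 - 1 / 2) + (m * j ^ 2 + 2 * s * j) * τ) *
          ex (z + τ / 2 - 1 / 2 + 2 * j * τ) := by
      rw [← ex_add]
      congr 1
      push_cast
      ring
    have e2 : s * (τ / 2 - 1 / 2) + ((m * j + s) * z + (m * j ^ 2 + 2 * s * j) * τ) =
        m * j * z + s * (z + τ / 2 - 1 / 2) + (m * j ^ 2 + 2 * s * j) * τ := by ring
    rw [e1, e2]
    ring
  · rw [← mul_assoc, ← ex_add]
    congr 2

/-! ### The value at the zero `1 / 2 - τ / 2` of `θ_{-1/2,1}` -/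

theorem den_half_sub {τ : ℂ} (hτ : 0 < τ.im) : den τ (1 / 2 - τ / 2) = 0 := by
  rw [den_eq_mul_tsum hτ, show (1 / 2 - τ / 2 + τ / 2 - 1 / 2 : ℂ) = 0 by ring, ex_zero, sub_self,
    zero_mul]

theorem ex_eq_one_iff (u : ℂ) : ex u = 1 ↔ ∃ n : ℤ, u = n := by
  rw [ex, Complex.exp_eq_one_iff]
  have h : (2 * Real.pi * I : ℂ) ≠ 0 := Complex.two_pi_I_ne_zero
  refine exists_congr fun n => ?_
  rw [mul_comm (n : ℂ)]
  exact mul_right_inj' h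

theorem hasSum_prodSum_half_sub {m : ℝ} (hm : 1 ≤ m) (s : ℝ) {τ : ℂ} (hτ : 0 < τ.im) :
    HasSum (fun i : ℕ => (-1) ^ i * (2 * i + 1) * ex (-1 / 8) *
      ex ((((i + 1 / 2) ^ 2 - 1 / 16 : ℝ) : ℂ) * τ)) (prodSum m s τ (1 / 2 - τ / 2)) := by
  have h := hasSum_prodSum_fst hm s hτ (1 / 2 - τ / 2)
  -- At `1/2 - τ/2 + 2 j τ` the function `θ_{-1/2,1}` vanishes while its linear factor `1 - e(2 j
  -- τ)` does not, so the quotient vanishes and only `j = 0` contributes.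
  have h0 : ∀ j : ℤ, j ≠ 0 → ∑' x, quotTerm τ (1 / 2 - τ / 2 + 2 * j * τ) x = 0 := by
    intro j hj
    have h1 := den_eq_mul_den_add hτ (1 / 2 - τ / 2) j
    rw [den_half_sub hτ, den_eq_mul_tsum hτ] at h1
    have h2 := (mul_eq_zero.1 h1.symm).resolve_left (ex_ne_zero _)
    refine (mul_eq_zero.1 h2).resolve_left fun h3 => ?_
    obtain ⟨n, hn⟩ := (ex_eq_one_iff _).1 (sub_eq_zero.1 h3).symm
    have h4 := congrArg Complex.im hn
    rw [show (1 / 2 - τ / 2 + 2 * j * τ + τ / 2 - 1 / 2 : ℂ) = ((2 * j : ℝ) : ℂ) * τ by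
      push_cast; ring, Complex.im_ofReal_mul] at h4
    simp only [Complex.intCast_im] at h4
    have : (j : ℝ) ≠ 0 := by exact_mod_cast hj
    have h5 : (2 * (j : ℝ)) ≠ 0 := by positivity
    exact (mul_ne_zero h5 hτ.ne') h4
  have h1 := h.unique (hasSum_single (0 : ℤ) fun j hj => by rw [h0 j hj, mul_zero])
  rw [h1]
  have h2 := (summable_quotTerm hτ (1 / 2 - τ / 2)).hasSum.sigma fun i => hasSum_fintype _
  refine hasSum_of_eq h2 (fun i => ?_) ?_
  · have e : ∀ a : Fin (2 * i + 1), quotTerm τ (1 / 2 - τ / 2) ⟨i, a⟩ =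
        (-1) ^ i * (ex (-1 / 8) * ex ((((i + 1 / 2) ^ 2 - 1 / 16 : ℝ) : ℂ) * τ)) := by
      intro a
      rw [quotTerm, ← ex_add]
      congr 2
      push_cast
      ring
    simp_rw [e]
    rw [Finset.sum_const, Finset.card_univ, Fintype.card_fin, nsmul_eq_mul]
    push_cast
    ring
  · rw [show ((m + 1) * ((0 : ℤ) : ℂ) * (1 / 2 - τ / 2) + s * (1 / 2 - τ / 2 + τ / 2 - 1 / 2) +
      ((m + 1) * ((0 : ℤ) : ℂ) ^ 2 + 2 * s * ((0 : ℤ) : ℂ)) * τ) = 0 by push_cast; ring, ex_zero,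
      one_mul]
    simp

theorem prodSum_half_sub_mem_qInt {m : ℝ} (hm : 1 ≤ m) (s : ℝ) :
    (fun τ : UpperHalfPlane => prodSum m s τ (1 / 2 - τ / 2)) ∈ qInt := by
  simp_rw [fun τ : UpperHalfPlane => (hasSum_prodSum_half_sub hm s τ.coe_im_pos).tsum_eq.symm]
  refine tsum_mem_qInt _ _ (3 / 16) (fun i => 2 * (i ^ 2 + i)) (fun i => ?_) fun τ =>
    (hasSum_prodSum_half_sub hm s τ.coe_im_pos).summable
  push_cast
  ring

theorem prodSum_half_sub_ne_zero {m : ℝ} (hm : 1 ≤ m) (s : ℝ) :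
    (fun τ : UpperHalfPlane => prodSum m s τ (1 / 2 - τ / 2)) ≠ 0 := by
  simp_rw [fun τ : UpperHalfPlane => (hasSum_prodSum_half_sub hm s τ.coe_im_pos).tsum_eq.symm]
  refine tsum_ne_zero_of_unique_min _ _ 0 ?_ (fun i hi => ?_) fun τ =>
    (hasSum_prodSum_half_sub hm s τ.coe_im_pos).summable
  · simpa using ex_ne_zero _
  · have : (0 : ℝ) < i := by exact_mod_cast Nat.pos_of_ne_zero hi
    push_cast
    nlinarith

/-! ### Values at real points -/

theorem prodTerm_eq_qpow (m s a : ℝ) (τ : ℂ) (j : ℤ) (x : QuotIndex) :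
    prodTerm m s τ a (j, x) = (-1) ^ x.1 * ex ((m + 1) * j * a +
      (s - 1 / 4 + (x.2 : ℕ) - x.1) * (a - 1 / 2) - 1 / 8) *
      ex ((((s - 1 / 4 + (x.2 : ℕ) - x.1) / 2 + ((m + 1) * j ^ 2 +
        2 * (s - 1 / 4 + (x.2 : ℕ) - x.1) * j + ((x.1 + 1 / 2) ^ 2 - 1 / 16)) : ℝ) : ℂ) * τ) := by
  rw [prodTerm_eq, mul_assoc ((-1 : ℂ) ^ x.1), ← ex_add]
  congr 2
  push_cast
  ring

theorem prodSum_mem_qInt {m : ℕ} (hm : 0 < m) {s : ℝ} {C : ℤ} (hs : 2 * s = C) (a : ℝ) :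
    (fun τ : UpperHalfPlane => prodSum m s τ a) ∈ qInt := by
  have hm1 : (1 : ℝ) ≤ m := by exact_mod_cast hm
  -- Twice the exponent of `q` without its constant `s + 1/8`, shifted by `(2C - 1)²` to be
  -- nonnegative.
  let N : ℤ × QuotIndex → ℤ := fun p => 2 * (m + 1) * p.1 ^ 2 +
    (2 * C - 1 + 4 * ((p.2.2 : ℕ) - p.2.1)) * p.1 + ((p.2.2 : ℕ) - p.2.1) + 2 * p.2.1 ^ 2 +
      2 * p.2.1 + (2 * C - 1) ^ 2
  have hN : ∀ p, 0 ≤ N p := by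
    rintro ⟨j, i, x⟩
    simp only [N]
    have hm' : (0 : ℤ) ≤ m - 1 := by
      have : (1 : ℤ) ≤ m := by exact_mod_cast hm
      linarith
    have hx : ((x : ℕ) : ℤ) ≤ 2 * i := by
      have := x.2
      exact_mod_cast Nat.lt_succ_iff.1 this
    have hx0 : (0 : ℤ) ≤ ((x : ℕ) : ℤ) := by positivity
    have hi : (0 : ℤ) ≤ i := by positivity
    have h1 : (((x : ℕ) : ℤ) - i) ^ 2 ≤ (i : ℤ) ^ 2 := by nlinarith
    nlinarith [sq_nonneg (j + (((x : ℕ) : ℤ) - i)), sq_nonneg (j + (2 * C - 1)), sq_nonneg j,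
      sq_nonneg (2 * C - 1), mul_nonneg hm' (sq_nonneg j)]
  have e : (fun τ : UpperHalfPlane => prodSum m s τ a) = fun τ : UpperHalfPlane =>
      ∑' p : ℤ × QuotIndex, (-1) ^ p.2.1 * ex (((m : ℝ) + 1) * p.1 * a +
        (s - 1 / 4 + (p.2.2 : ℕ) - p.2.1) * (a - 1 / 2) - 1 / 8) *
        ex ((((s - 1 / 4 + (p.2.2 : ℕ) - p.2.1) / 2 + ((m + 1) * p.1 ^ 2 +
          2 * (s - 1 / 4 + (p.2.2 : ℕ) - p.2.1) * p.1 + ((p.2.1 + 1 / 2) ^ 2 - 1 / 16)) :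
            ℝ) : ℂ) * τ) :=
    funext fun τ => tsum_congr fun p => prodTerm_eq_qpow m s a τ p.1 p.2
  rw [e]
  refine tsum_mem_qInt _ _ ((s + 1 / 8 - (2 * C - 1) ^ 2) / 2) (fun p => (N p).toNat)
    (fun p => ?_) fun τ => (summable_prodTerm hm1 s τ.coe_im_pos a).congr fun p =>
      prodTerm_eq_qpow m s a τ p.1 p.2
  have h1 : (((N p).toNat : ℤ) : ℝ) = (N p : ℝ) := by rw [Int.toNat_of_nonneg (hN p)]
  rw [Int.cast_natCast] at h1
  rw [h1]
  simp only [N]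
  push_cast
  rw [← hs]
  ring

/-! ### A finite-dimensional space of theta functions -/

/-- The span of `θ_{c+2n,m+1}(τ, ·)`, `0 ≤ n ≤ m`. -/
def thetaSpace (m : ℕ) (c : ℝ) (τ : ℂ) : Submodule ℂ (ℂ → ℂ) :=
  Submodule.span ℂ (Set.range fun n : Fin (m + 1) => theta (c + 2 * (n : ℕ)) (m + 1) τ)

instance (m : ℕ) (c : ℝ) (τ : ℂ) : FiniteDimensional ℂ (thetaSpace m c τ) :=
  FiniteDimensional.span_of_finite ℂ (Set.finite_range _)

theorem finrank_thetaSpace_le (m : ℕ) (c : ℝ) (τ : ℂ) :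
    Module.finrank ℂ (thetaSpace m c τ) ≤ m + 1 := by
  have h := finrank_range_le_card (R := ℂ)
    (fun n : Fin (m + 1) => theta (c + 2 * (n : ℕ)) (m + 1) τ)
  rwa [Fintype.card_fin] at h

theorem theta_mem_thetaSpace (m : ℕ) (c : ℝ) (τ : ℂ) (n : ℤ) :
    theta (c + 2 * n) (m + 1) τ ∈ thetaSpace m c τ := by
  have hpos : (0 : ℤ) < m + 1 := by positivity
  have h0 := Int.emod_nonneg n hpos.ne'
  have h1 := Int.emod_lt_of_pos n hpos
  have h2 := Int.emod_add_mul_ediv n (m + 1)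
  obtain ⟨r, hr⟩ := Int.eq_ofNat_of_zero_le h0
  rw [hr] at h1 h2
  have hM : ((m : ℝ) + 1) ≠ 0 := by positivity
  have e : c + 2 * (n : ℝ) = c + 2 * r + ((n / (m + 1) : ℤ) : ℝ) * (2 * ((m : ℝ) + 1)) := by
    have h3 : (n : ℝ) = r + ((m : ℝ) + 1) * ((n / (m + 1) : ℤ) : ℝ) := by exact_mod_cast h2.symm
    linear_combination 2 * h3
  have e' : theta (c + 2 * n) (m + 1) τ = theta (c + 2 * r) (m + 1) τ := by
    funext z
    rw [e, theta_add_int_mul_period _ hM]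
  rw [e']
  exact Submodule.subset_span ⟨⟨r, by exact_mod_cast h1⟩, rfl⟩

/-- A finite-dimensional subspace is closed for pointwise convergence. Membership in `thetaSpace`
thus follows from regrouping series, with no use of quasi-periodicity of entire functions. -/
theorem mem_of_hasSum_of_finiteDimensional {ι : Type*} (W : Submodule ℂ (ℂ → ℂ))
    [FiniteDimensional ℂ W] {f : ι → ℂ → ℂ} {g : ℂ → ℂ} (hf : ∀ i, f i ∈ W)
    (h : ∀ z, HasSum (fun i => f i z) (g z)) : g ∈ W :=
  (Submodule.closed_of_finiteDimensional W).mem_of_tendsto (Pi.hasSum.2 h)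
    (Eventually.of_forall fun _ => W.sum_mem fun i _ => hf i)

theorem prodSum_mem_thetaSpace {m : ℕ} (hm : 0 < m) (s : ℝ) {τ : ℂ} (hτ : 0 < τ.im) :
    prodSum m s τ ∈ thetaSpace m (2 * s - 1 / 2) τ := by
  have hm1 : (1 : ℝ) ≤ m := by exact_mod_cast hm
  let σ : QuotIndex → ℝ := fun x => s - 1 / 4 + (x.2 : ℕ) - x.1
  let f : QuotIndex → ℂ → ℂ := fun x => ((-1) ^ x.1 *
    ex (σ x * (τ / 2 - 1 / 2) + ((x.1 + 1 / 2) ^ 2 - 1 / 16) * τ - 1 / 8) *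
      ex (-((σ x) ^ 2 / ((m + 1 : ℝ) : ℂ) * τ))) • theta (2 * σ x) (m + 1) τ
  refine mem_of_hasSum_of_finiteDimensional _ (f := f) (fun x => ?_) fun z => ?_
  · refine Submodule.smul_mem _ _ ?_
    have := theta_mem_thetaSpace m (2 * s - 1 / 2) τ ((x.2 : ℕ) - x.1)
    convert this using 2
    simp only [σ]
    push_cast
    ring
  -- Summing over `j` first, for fixed `x`, gives a multiple of `θ_{2σ(x),m+1}`.
  · have h := (Equiv.prodComm QuotIndex ℤ).hasSum_iff.2 (summable_prodTerm hm1 s hτ z).hasSum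
    refine h.prod_fiberwise fun x => ?_
    have h1 := (hasSum_theta (by positivity : (0 : ℝ) < m + 1) (σ x) hτ z).mul_left ((-1) ^ x.1 *
      ex (σ x * (τ / 2 - 1 / 2) + ((x.1 + 1 / 2) ^ 2 - 1 / 16) * τ - 1 / 8))
    refine hasSum_of_eq h1 (fun j => ?_) ?_
    · simp only [Function.comp_apply, Equiv.prodComm_apply, Prod.swap_prod_mk]
      rw [prodTerm_eq, mul_assoc ((-1 : ℂ) ^ x.1), ← ex_add]
      congr 2
      simp only [σ]
      push_cast
      ring
    · simp only [f, Pi.smul_apply, smul_eq_mul]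
      ring

theorem theta_mul_den_mem_thetaSpace {m : ℕ} (hm : 0 < m) (s : ℝ) (k : ℕ) {τ : ℂ}
    (hτ : 0 < τ.im) :
    (fun z => theta (2 * (s + k)) m τ z * den τ z) ∈ thetaSpace m (2 * s - 1 / 2) τ := by
  have hm0 : (0 : ℝ) < m := by exact_mod_cast hm
  let σ : ℤ → ℝ := fun ν => s + k - ν - 1 / 4
  let f : ℤ → ℂ → ℂ := fun ν => (ex ((ν + 1 / 4) ^ 2 * τ + (((s + k) ^ 2 / m : ℝ) : ℂ) * τ) *
    ex (-((σ ν) ^ 2 / ((m + 1 : ℝ) : ℂ) * τ))) • theta (2 * σ ν) (m + 1) τ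
  -- The new first coordinate `ν` is the sum of the two summation indices; for fixed `ν` the sum
  -- over `j` has leading form `(m+1) j²` and is a theta series of degree `m + 1`.
  let e : ℤ × ℤ ≃ ℤ × ℤ :=
    { toFun := fun p => (p.2, p.1 - p.2)
      invFun := fun p => (p.1 + p.2, p.1)
      left_inv := fun p => by ext <;> simp
      right_inv := fun p => by ext <;> simp }
  refine mem_of_hasSum_of_finiteDimensional _ (f := f) (fun ν => ?_) fun z => ?_
  · refine Submodule.smul_mem _ _ ?_
    have := theta_mem_thetaSpace m (2 * s - 1 / 2) τ (k - ν)
    convert this using 2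
    simp only [σ]
    push_cast
    ring
  · have hA := (hasSum_theta hm0 (s + k) hτ z)
    have hB := hasSum_den hτ z
    have hsum := summable_mul_of_summable_norm hA.summable.norm hB.summable.norm
    have hAB := HasSum.mul hA hB hsum
    have h := (e.hasSum_iff.2 hAB).mul_left (ex (((s + k : ℝ) : ℂ) ^ 2 / m * τ))
    have e0 : theta (2 * (s + k)) m τ z * den τ z = ex (((s + k : ℝ) : ℂ) ^ 2 / m * τ) *
        (ex (-(((s + k : ℝ) : ℂ) ^ 2 / ((m : ℝ) : ℂ) * τ)) * theta (2 * (s + k)) m τ z *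
          den τ z) := by
      rw [← mul_assoc, ← mul_assoc, ← ex_add, Complex.ofReal_natCast, add_neg_cancel, ex_zero,
        one_mul]
    rw [e0]
    refine h.prod_fiberwise fun ν => ?_
    have h1 := (hasSum_theta (by positivity : (0 : ℝ) < m + 1) (σ ν) hτ z).mul_left
      (ex ((ν + 1 / 4) ^ 2 * τ + (((s + k) ^ 2 / m : ℝ) : ℂ) * τ))
    refine hasSum_of_eq h1 (fun j => ?_) ?_
    · simp only [Function.comp_apply, e, Equiv.coe_fn_mk]
      rw [← ex_add, ← ex_add, ← ex_add]
      congr 1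
      simp only [σ]
      push_cast
      ring
    · simp only [f, Pi.smul_apply, smul_eq_mul]
      ring

/-! ### Expansion of `θ_{2s-1/2,m+1}` -/

/-- The phases `e(j l)` are trivial, so at the points `l/m` the functions `θ_{2(s+k),m}` become
characters in `l`, which finite Fourier inversion separates. -/
theorem theta_natCast_div {m : ℕ} (hm : 0 < m) (σ : ℝ) (τ : ℂ) (l : ℕ) :
    theta (2 * σ) m τ ((l : ℂ) / m) = ex (σ * l / m) * theta (2 * σ) m τ 0 := by
  have hm0 : (m : ℝ) ≠ 0 := by positivity
  have hm1 : (m : ℂ) ≠ 0 := by exact_mod_cast hm.ne'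
  rw [theta_eq_mul_tsum hm0, theta_eq_mul_tsum hm0, mul_left_comm]
  congr 1
  rw [← tsum_mul_left]
  refine tsum_congr fun j => ?_
  rw [← ex_add, ← ex_add_int (_ + _) (-(j * l))]
  congr 1
  push_cast
  field_simp
  ring

theorem sum_ex_mul_ex {m : ℕ} (s : ℝ) (k k' : Fin m) :
    ∑ l : Fin m, ex (-(s + (k : ℕ)) * (l : ℕ) / m) * ex ((s + (k' : ℕ)) * (l : ℕ) / m) =
      if k' = k then (m : ℂ) else 0 := by
  have hm : 0 < m := k.pos
  have hm1 : (m : ℂ) ≠ 0 := by exact_mod_cast hm.ne'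
  set ζ := ex (((k' : ℕ) - (k : ℕ)) / m) with hζ
  have h1 : ∀ l : Fin m, ex (-(s + (k : ℕ)) * (l : ℕ) / m) * ex ((s + (k' : ℕ)) * (l : ℕ) / m) =
      ζ ^ (l : ℕ) := by
    intro l
    rw [hζ, ← ex_nat_mul, ← ex_add]
    congr 1
    field_simp
    ring
  simp_rw [h1]
  rw [Fin.sum_univ_eq_sum_range (fun l => ζ ^ l) m]
  split_ifs with h
  · have : ζ = 1 := by rw [hζ, h, sub_self, zero_div, ex_zero]
    simp [this]
  · have h2 : ζ ≠ 1 := by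
      intro h3
      obtain ⟨n, hn⟩ := (ex_eq_one_iff _).1 h3
      rw [div_eq_iff hm1] at hn
      have h4 : ((k' : ℕ) : ℤ) - (k : ℕ) = n * m := by exact_mod_cast hn
      have h5 := k.2
      have h6 := k'.2
      have h7 : |n * (m : ℤ)| < m := by
        rw [← h4, abs_lt]
        constructor <;> omega
      have h8 : n = 0 := by
        by_contra h9
        have h10 := Int.one_le_abs h9
        rw [abs_mul, Nat.abs_cast] at h7
        nlinarith
      rw [h8, zero_mul] at h4
      exact h (Fin.ext (by omega))
    have h3 : ζ ^ m = 1 := by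
      rw [hζ, ← ex_nat_mul, mul_div_cancel₀ _ hm1]
      have := ex_int ((k' : ℕ) - (k : ℕ))
      push_cast at this
      exact this
    rw [geom_sum_eq h2, h3, sub_self, zero_div]

/-- The coefficient of the Appell function in the expansion of `f / θ_{-1/2,1}`. -/
def leadCoeff (m s : ℝ) (τ : ℂ) (f : ℂ → ℂ) : ℂ :=
  f (1 / 2 - τ / 2) / prodSum m s τ (1 / 2 - τ / 2)

/-- The coefficient of `θ_{2(s+k),m}` in the expansion of `f / θ_{-1/2,1}`. -/
def thetaCoeff (m : ℕ) (s : ℝ) (τ : ℂ) (f : ℂ → ℂ) (k : Fin m) : ℂ :=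
  (m * theta (2 * (s + (k : ℕ))) m τ 0)⁻¹ * ∑ l : Fin m, ex (-(s + (k : ℕ)) * (l : ℕ) / m) *
    ((f ((l : ℕ) / m) - leadCoeff m s τ f * prodSum m s τ ((l : ℕ) / m)) *
      (den τ ((l : ℕ) / m))⁻¹)

/-- Serves twice: with `f = 0` it yields linear independence, and for `θ_{2s-1/2,m+1}` it yields the
explicit coefficients whose dependence on `τ` can be controlled. -/
theorem eq_coeff_of_expansion {m : ℕ} (s : ℝ) {τ : ℂ} (hτ : 0 < τ.im)
    (h0 : prodSum m s τ (1 / 2 - τ / 2) ≠ 0) (hD : ∀ l : Fin m, den τ ((l : ℕ) / m) ≠ 0)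
    (hθ : ∀ k : Fin m, theta (2 * (s + (k : ℕ))) m τ 0 ≠ 0) {f : ℂ → ℂ} {A : ℂ} {c : Fin m → ℂ}
    (hf : ∀ z, f z = A * prodSum m s τ z +
      ∑ k : Fin m, c k * (theta (2 * (s + (k : ℕ))) m τ z * den τ z)) :
    A = leadCoeff m s τ f ∧ c = thetaCoeff m s τ f := by
  have hA : A = leadCoeff m s τ f := by
    rw [leadCoeff, hf, den_half_sub hτ, eq_div_iff h0]
    simp
  refine ⟨hA, funext fun k => ?_⟩
  have hm : 0 < m := k.pos
  have hm1 : (m : ℂ) ≠ 0 := by exact_mod_cast hm.ne'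
  have h1 : ∀ l : Fin m, (f ((l : ℕ) / m) - leadCoeff m s τ f * prodSum m s τ ((l : ℕ) / m)) *
      (den τ ((l : ℕ) / m))⁻¹ = ∑ k' : Fin m, (c k' * theta (2 * (s + (k' : ℕ))) m τ 0) *
        ex ((s + (k' : ℕ)) * (l : ℕ) / m) := by
    intro l
    rw [← hA, hf, add_sub_cancel_left, Finset.sum_mul]
    refine Finset.sum_congr rfl fun k' _ => ?_
    rw [theta_natCast_div hm]
    push_cast
    field_simp [hD l]
  rw [thetaCoeff]
  simp_rw [h1, Finset.mul_sum]
  rw [Finset.sum_comm]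
  have h2 : ∀ k' : Fin m, ∑ l : Fin m, (m * theta (2 * (s + (k : ℕ))) m τ 0)⁻¹ *
      (ex (-(s + (k : ℕ)) * (l : ℕ) / m) * (c k' * theta (2 * (s + (k' : ℕ))) m τ 0 *
        ex ((s + (k' : ℕ)) * (l : ℕ) / m))) = (m * theta (2 * (s + (k : ℕ))) m τ 0)⁻¹ *
      (c k' * theta (2 * (s + (k' : ℕ))) m τ 0) * if k' = k then (m : ℂ) else 0 := by
    intro k'
    rw [← sum_ex_mul_ex s k k', Finset.mul_sum]
    refine Finset.sum_congr rfl fun l _ => ?_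
    ring
  simp_rw [h2]
  rw [Finset.sum_eq_single k (fun k' _ hk' => by rw [if_neg hk', mul_zero]) (by simp), if_pos rfl]
  field_simp [hθ k]

theorem theta_eq_expansion {m : ℕ} (hm : 0 < m) (s : ℝ) {τ : ℂ} (hτ : 0 < τ.im)
    (h0 : prodSum m s τ (1 / 2 - τ / 2) ≠ 0) (hD : ∀ l : Fin m, den τ ((l : ℕ) / m) ≠ 0)
    (hθ : ∀ k : Fin m, theta (2 * (s + (k : ℕ))) m τ 0 ≠ 0) (z : ℂ) :
    theta (2 * s - 1 / 2) (m + 1) τ z =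
      leadCoeff m s τ (theta (2 * s - 1 / 2) (m + 1) τ) * prodSum m s τ z +
      ∑ k : Fin m, thetaCoeff m s τ (theta (2 * s - 1 / 2) (m + 1) τ) k *
        (theta (2 * (s + (k : ℕ))) m τ z * den τ z) := by
  let v : Option (Fin m) → ℂ → ℂ := fun o => o.elim (prodSum m s τ)
    fun k z => theta (2 * (s + (k : ℕ))) m τ z * den τ z
  have hv : ∀ (g : Option (Fin m) → ℂ) (z : ℂ), (∑ o, g o • v o) z = g none * prodSum m s τ z +
      ∑ k : Fin m, g (some k) * (theta (2 * (s + (k : ℕ))) m τ z * den τ z) := by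
    intro g z
    rw [Fintype.sum_option]
    simp [v, Finset.sum_apply]
  have hli : LinearIndependent ℂ v := by
    rw [Fintype.linearIndependent_iff]
    intro g hg
    have h1 := eq_coeff_of_expansion s hτ h0 hD hθ (f := 0) (A := g none)
      (c := fun k => g (some k)) fun z => by rw [← hv, hg]
    have h2 : leadCoeff m s τ 0 = 0 := by simp [leadCoeff]
    have h3 : thetaCoeff m s τ 0 = 0 := by
      funext k
      simp [thetaCoeff, h2]
    rintro (_ | k)
    · rw [h1.1, h2]
    · rw [congrFun h1.2 k, h3, Pi.zero_apply]
  have hle : Submodule.span ℂ (Set.range v) ≤ thetaSpace m (2 * s - 1 / 2) τ := by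
    rw [Submodule.span_le]
    rintro _ ⟨_ | k, rfl⟩
    · exact prodSum_mem_thetaSpace hm s hτ
    · exact theta_mul_den_mem_thetaSpace hm s k hτ
  -- Independence gives dimension `m + 1` for the span, and `thetaSpace` has dimension at most `m +
  -- 1`.
  have heq := Submodule.eq_of_le_of_finrank_le hle (by
    rw [finrank_span_eq_card hli, Fintype.card_option, Fintype.card_fin]
    exact finrank_thetaSpace_le m _ τ)
  have hmem : theta (2 * s - 1 / 2) (m + 1) τ ∈ Submodule.span ℂ (Set.range v) := by
    rw [heq]
    simpa using theta_mem_thetaSpace m (2 * s - 1 / 2) τ 0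
  obtain ⟨g, hg⟩ := (Submodule.mem_span_range_iff_exists_fun ℂ).1 hmem
  have hexp : ∀ z, theta (2 * s - 1 / 2) (m + 1) τ z = g none * prodSum m s τ z +
      ∑ k : Fin m, g (some k) * (theta (2 * (s + (k : ℕ))) m τ z * den τ z) := by
    intro z
    rw [← hv, hg]
  have h1 := eq_coeff_of_expansion s hτ h0 hD hθ hexp
  rw [← h1.1, ← h1.2]
  exact hexp z

/-! ### Coefficients in `ℂ((q^{1/2}))` -/

/-- A function of `τ` as a function of `(τ, z)`. -/
def coef (φ : UpperHalfPlane → ℂ) : Fun := Germ.ofFun fun p : UpperHalfPlane × ℂ => φ p.1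

theorem coef_mem_qFrac {φ : UpperHalfPlane → ℂ} (h : φ ∈ qInt) : coef φ ∈ qFrac := by
  refine ⟨φ, h, 1, one_mem _, one_ne_zero, Germ.coe_eq.2 (Eventually.of_forall fun p => ?_)⟩
  simp

theorem coef_inv_mem_qFrac {φ : UpperHalfPlane → ℂ} (h : φ ∈ qInt) (h0 : φ ≠ 0) :
    coef φ⁻¹ ∈ qFrac := by
  refine ⟨1, one_mem _, φ, h, h0, Germ.coe_eq.2 (Eventually.of_forall fun p => ?_)⟩
  simp

theorem coef_mul_mem_qFrac {φ ψ : UpperHalfPlane → ℂ} (h : coef φ ∈ qFrac) (h' : coef ψ ∈ qFrac) :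
    coef (fun τ => φ τ * ψ τ) ∈ qFrac :=
  qFrac.mul_mem h h'

theorem coef_sub_mem_qFrac {φ ψ : UpperHalfPlane → ℂ} (h : coef φ ∈ qFrac) (h' : coef ψ ∈ qFrac) :
    coef (fun τ => φ τ - ψ τ) ∈ qFrac :=
  qFrac.sub_mem h h'

theorem coef_sum_mem_qFrac {ι : Type*} (s : Finset ι) {φ : ι → UpperHalfPlane → ℂ}
    (h : ∀ i ∈ s, coef (φ i) ∈ qFrac) : coef (fun τ => ∑ i ∈ s, φ i τ) ∈ qFrac := by
  classical
  induction s using Finset.induction_on with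
  | empty => exact qFrac.zero_mem
  | insert a s ha ih =>
    simp_rw [Finset.sum_insert ha]
    exact qFrac.add_mem (h a (Finset.mem_insert_self a s))
      (ih fun i hi => h i (Finset.mem_insert_of_mem hi))

theorem mul_ex_mem_qInt (a : ℂ) (b : ℝ) : (fun τ : UpperHalfPlane => a * ex (b * τ)) ∈ qInt := by
  have h := tsum_mem_qInt (fun _ : Unit => a) (fun _ => b) b (fun _ => 0) (fun _ => by simp)
    fun τ => (hasSum_fintype _).summable
  simpa using h

theorem coef_const_mem_qFrac (a : ℂ) : coef (fun _ => a) ∈ qFrac := by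
  have h := coef_mem_qFrac (mul_ex_mem_qInt a 0)
  simpa [ex_zero] using h

theorem den_mem_qInt (a : ℝ) : (fun τ : UpperHalfPlane => den τ a) ∈ qInt := by
  have h := theta_mem_qInt (M := 1) (N := 1) (by simp) one_pos (-1 / 4) a 0 (-1) (by norm_num)
  simpa [den, show (2 * (-1 / 4) : ℝ) = -1 / 2 by norm_num] using h

theorem den_ne_zero (a : ℝ) : (fun τ : UpperHalfPlane => den τ a) ≠ 0 := by
  have h := theta_ne_zero (M := 1) one_pos (-1 / 4) a 0 (by rw [abs_lt]; norm_num)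
  simpa [den, show (2 * (-1 / 4) : ℝ) = -1 / 2 by norm_num] using h

theorem den_neg (τ z : ℂ) : den τ (-z) = theta (1 / 2) 1 τ z := by
  rw [den, ← theta_neg_left]
  norm_num

theorem eventually_den_ne_zero :
    ∀ᶠ p : UpperHalfPlane × ℂ in denseOpen (UpperHalfPlane × ℂ), den p.1 p.2 ≠ 0 := by
  have h := (ne_zero_of_mem_qInt (den_mem_qInt 0) (den_ne_zero 0)).2
  exact eventually_theta_ne_zero _ one_pos ((0 : ℝ) : ℂ) h

theorem eventually_den_neg_ne_zero :
    ∀ᶠ p : UpperHalfPlane × ℂ in denseOpen (UpperHalfPlane × ℂ), den p.1 (-p.2) ≠ 0 := by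
  have h := (ne_zero_of_mem_qInt (den_mem_qInt 0) (den_ne_zero 0)).2
  simp_rw [den_neg]
  refine eventually_theta_ne_zero _ one_pos 0 ?_
  have e : ∀ τ : ℂ, theta (1 / 2) 1 τ 0 = den τ ((0 : ℝ) : ℂ) := by
    intro τ
    rw [← den_neg, neg_zero, Complex.ofReal_zero]
  simp_rw [e]
  exact h

theorem theta_natCast_zero_mem_qInt {m : ℕ} (hm : 0 < m) {σ : ℝ} {C : ℤ} (hσ : 2 * σ = C) :
    (fun τ : UpperHalfPlane => theta (2 * σ) m τ 0) ∈ qInt := by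
  have h := theta_mem_qInt (M := m) (N := m) rfl hm σ 0 0 (2 * C) (by push_cast; rw [← hσ]; ring)
  simpa using h

theorem theta_real_mem_qInt (m : ℕ) {s : ℝ} {C : ℤ} (hs : 2 * s = C) (a : ℝ) :
    (fun τ : UpperHalfPlane => theta (2 * s - 1 / 2) (m + 1) τ a) ∈ qInt := by
  have h := theta_mem_qInt (M := m + 1) (N := m + 1) (by push_cast; ring) m.succ_pos (s - 1 / 4) a 0
    (2 * C - 1) (by push_cast; rw [← hs]; ring)
  convert h using 3 with τ
  · ring
  · push_cast
    ring

theorem theta_half_sub_mem_qInt (m : ℕ) {s : ℝ} {C : ℤ} (hs : 2 * s = C) :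
    (fun τ : UpperHalfPlane => theta (2 * s - 1 / 2) (m + 1) τ (1 / 2 - τ / 2)) ∈ qInt := by
  have h := theta_mem_qInt (M := m + 1) (N := m + 1) (by push_cast; ring) m.succ_pos (s - 1 / 4)
    (1 / 2) (-1 / 2) (2 * C - m - 2) (by push_cast; rw [← hs]; ring)
  convert h using 3 with τ
  · ring
  · push_cast
    ring

/-- In this range `|2s - 1/2 - (m+1)/2| ≤ m/2 < m + 1`, so there is a single leading term. This
makes the coefficient of the Appell function invertible. -/
theorem theta_half_sub_ne_zero (m : ℕ) {s : ℝ} (h1 : 1 / 2 ≤ s) (h2 : s ≤ (m + 1) / 2) :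
    (fun τ : UpperHalfPlane => theta (2 * s - 1 / 2) (m + 1) τ (1 / 2 - τ / 2)) ≠ 0 := by
  have hm : (0 : ℝ) ≤ m := by positivity
  have h := theta_ne_zero (M := m + 1) (by positivity) (s - 1 / 4) (1 / 2) (-1 / 2)
    (by rw [abs_lt]; constructor <;> linarith)
  convert h using 3 with τ
  · ring
  · push_cast
    ring

theorem coef_leadCoeff_mem_qFrac {m : ℕ} (hm : 0 < m) {s : ℝ} {C : ℤ} (hs : 2 * s = C) :
    coef (fun τ => leadCoeff m s τ (theta (2 * s - 1 / 2) (m + 1) τ)) ∈ qFrac := by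
  have hm1 : (1 : ℝ) ≤ m := by exact_mod_cast hm
  exact coef_mul_mem_qFrac (coef_mem_qFrac (theta_half_sub_mem_qInt m hs))
    (coef_inv_mem_qFrac (prodSum_half_sub_mem_qInt hm1 s) (prodSum_half_sub_ne_zero hm1 s))

theorem coef_leadCoeff_inv_mem_qFrac {m : ℕ} (hm : 0 < m) {s : ℝ} {C : ℤ} (hs : 2 * s = C)
    (h1 : 1 / 2 ≤ s) (h2 : s ≤ (m + 1) / 2) :
    coef (fun τ => (leadCoeff m s τ (theta (2 * s - 1 / 2) (m + 1) τ))⁻¹) ∈ qFrac := by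
  have hm1 : (1 : ℝ) ≤ m := by exact_mod_cast hm
  simp_rw [leadCoeff, inv_div, div_eq_mul_inv]
  exact coef_mul_mem_qFrac (coef_mem_qFrac (prodSum_half_sub_mem_qInt hm1 s))
    (coef_inv_mem_qFrac (theta_half_sub_mem_qInt m hs) (theta_half_sub_ne_zero m h1 h2))

theorem coef_thetaCoeff_mem_qFrac {m : ℕ} (hm : 0 < m) {s : ℝ} {C : ℤ} (hs : 2 * s = C)
    (k : Fin m) :
    coef (fun τ => thetaCoeff m s τ (theta (2 * s - 1 / 2) (m + 1) τ) k) ∈ qFrac := by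
  have hk : 2 * (s + (k : ℕ)) = ((C + 2 * (k : ℕ) : ℤ) : ℝ) := by
    push_cast
    rw [← hs]
    ring
  have hp : ∀ l : Fin m, ((l : ℕ) : ℂ) / m = (((l : ℕ) / m : ℝ) : ℂ) := by
    intro l
    push_cast
    rfl
  simp_rw [thetaCoeff, mul_inv, hp]
  refine coef_mul_mem_qFrac (coef_mul_mem_qFrac (coef_const_mem_qFrac _) (coef_inv_mem_qFrac
    (theta_natCast_zero_mem_qInt hm hk) (theta_zero_ne_zero (by exact_mod_cast hm) _)))
    (coef_sum_mem_qFrac _ fun l _ => coef_mul_mem_qFrac (coef_const_mem_qFrac _)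
      (coef_mul_mem_qFrac (coef_sub_mem_qFrac (coef_mem_qFrac (theta_real_mem_qInt m hs _))
        (coef_mul_mem_qFrac (coef_leadCoeff_mem_qFrac hm hs)
          (coef_mem_qFrac (prodSum_mem_qInt hm hs _))))
        (coef_inv_mem_qFrac (den_mem_qInt _) (den_ne_zero _))))

/-! ### Relations between the generators -/

theorem Phi_eq_appell (m s : ℝ) (τ z : ℂ) :
    Phi (m / 2) s (2 * τ) (z + τ / 2 - 1 / 2) (z - τ / 2 + 1 / 2) (τ / 8) =
      ex (((-m / 16 : ℝ) : ℂ) * τ) * (appell m s τ z - appell m s τ (-z)) := by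
  rw [Phi, Phi₁, Phi₂, appell, appell]
  have e : cexp (-2 * Real.pi * I * ((m / 2 : ℝ) : ℂ) * (τ / 8)) =
      ex (((-m / 16 : ℝ) : ℂ) * τ) := by
    rw [ex]
    congr 1
    push_cast
    ring
  rw [e, mul_sub (ex _)]
  refine congrArg₂ (· - ·) (congrArg _ (tsum_congr fun j => ?_))
    (congrArg _ (tsum_congr fun j => ?_))
  · rw [appellTerm, ex, ex]
    congr 2
    · congr 1
      push_cast
      ring
    · congr 2
      ring
  · rw [appellTerm, ex, ex]
    congr 2
    · congr 1
      push_cast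
      ring
    · congr 2
      ring

/-- `[θ_{κ,m} - θ_{-κ,m}](τ, z)` with a real index `κ`. -/
def thetaOdd (κ : ℝ) (m : ℕ) : Fun :=
  toFun fun τ z => theta κ m τ z - theta (-κ) m τ z

theorem phiFun_sub_phiFun_add_one {m : ℕ} (hm : 0 < m) (s : ℝ) :
    phiFun m s - phiFun m (s + 1) = coef (fun τ => ex (-s / 2) *
      ex (((-m / 16 + s / 2 - s ^ 2 / m : ℝ) : ℂ) * τ)) * thetaOdd (2 * s) m := by
  have hm1 : (1 : ℝ) ≤ m := by exact_mod_cast hm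
  refine Germ.coe_eq.2 ?_
  filter_upwards [eventually_den_ne_zero, eventually_den_neg_ne_zero] with p h1 h2
  have e1 := appell_sub_appell_add_one hm1 s p.1.coe_im_pos h1
  have e2 := appell_sub_appell_add_one hm1 s p.1.coe_im_pos h2
  have e3 : ex (((-(m : ℝ) / 16 : ℝ) : ℂ) * p.1) * ex (s * (p.1 / 2 - 1 / 2) - s ^ 2 / m * p.1) =
      ex (-s / 2) * ex (((-m / 16 + s / 2 - s ^ 2 / m : ℝ) : ℂ) * p.1) := by
    rw [← ex_add, ← ex_add]
    congr 1
    push_cast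
    ring
  simp only [Complex.ofReal_natCast] at e1 e2
  change Phi _ _ _ _ _ _ - Phi _ _ _ _ _ _ = _ * (theta _ _ _ _ - theta _ _ _ _)
  rw [Phi_eq_appell, Phi_eq_appell, ← e3, theta_neg_left, ← mul_sub, mul_assoc]
  congr 1
  linear_combination e1 - e2

/-- The expansion of `f = θ_{2s-1/2,m+1} / θ_{-1/2,1}` is taken at `z` and `-z` and subtracted;
`thetaRatio` is `f(z) - f(-z)`. The factor `q^{m/16}` cancels the prefactor of `phiFun`. -/
theorem thetaRatio_eq {m : ℕ} (hm : 0 < m) {s : ℝ} {C : ℤ} (hs : 2 * s = C) :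
    thetaRatio (2 * s - 1 / 2) m =
      coef (fun τ => leadCoeff m s τ (theta (2 * s - 1 / 2) (m + 1) τ) *
        (1 * ex (((m / 16 : ℝ) : ℂ) * τ))) * phiFun m s +
      ∑ k : Fin m, coef (fun τ => thetaCoeff m s τ (theta (2 * s - 1 / 2) (m + 1) τ) k) *
        thetaOdd (2 * (s + (k : ℕ))) m := by
  have hm1 : (1 : ℝ) ≤ m := by exact_mod_cast hm
  have hm0 : (0 : ℝ) < m := by exact_mod_cast hm
  have hk : ∀ k : Fin m, 2 * (s + (k : ℕ)) = ((C + 2 * (k : ℕ) : ℤ) : ℝ) := by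
    intro k
    push_cast
    rw [← hs]
    ring
  have hsum : ∑ k : Fin m, coef (fun τ => thetaCoeff m s τ (theta (2 * s - 1 / 2) (m + 1) τ) k) *
        thetaOdd (2 * (s + (k : ℕ))) m = Germ.ofFun fun p : UpperHalfPlane × ℂ =>
      ∑ k : Fin m, thetaCoeff m s p.1 (theta (2 * s - 1 / 2) (m + 1) p.1) k *
        (theta (2 * (s + (k : ℕ))) m p.1 p.2 - theta (-(2 * (s + (k : ℕ)))) m p.1 p.2) := by
    have h := map_sum (Germ.coeRingHom (R := ℂ) (denseOpen (UpperHalfPlane × ℂ)))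
      (fun (k : Fin m) (p : UpperHalfPlane × ℂ) =>
        thetaCoeff m s p.1 (theta (2 * s - 1 / 2) (m + 1) p.1) k *
        (theta (2 * (s + (k : ℕ))) m p.1 p.2 - theta (-(2 * (s + (k : ℕ)))) m p.1 p.2)) Finset.univ
    refine Eq.trans h.symm ?_
    refine congrArg Germ.ofFun (funext fun p => ?_)
    rw [Finset.sum_apply]
  rw [hsum]
  refine Germ.coe_eq.2 ?_
  have hD : ∀ᶠ p : UpperHalfPlane × ℂ in denseOpen (UpperHalfPlane × ℂ),
      ∀ l : Fin m, den p.1 ((l : ℕ) / m) ≠ 0 := by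
    rw [eventually_all]
    intro l
    have := eventually_ne_zero_of_mem_qInt (den_mem_qInt ((l : ℕ) / m)) (den_ne_zero _)
    simpa using this
  have hθ : ∀ᶠ p : UpperHalfPlane × ℂ in denseOpen (UpperHalfPlane × ℂ),
      ∀ k : Fin m, theta (2 * (s + (k : ℕ))) m p.1 0 ≠ 0 := by
    rw [eventually_all]
    intro k
    exact eventually_ne_zero_of_mem_qInt (theta_natCast_zero_mem_qInt hm (hk k))
      (theta_zero_ne_zero hm0 _)
  filter_upwards [eventually_den_ne_zero, eventually_den_neg_ne_zero, hD, hθ,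
    eventually_ne_zero_of_mem_qInt (prodSum_half_sub_mem_qInt hm1 s)
      (prodSum_half_sub_ne_zero hm1 s)] with p h1 h2 h3 h4 h5
  have hexp := theta_eq_expansion hm s p.1.coe_im_pos h5 h3 h4
  have hquot : ∀ z, den p.1 z ≠ 0 → theta (2 * s - 1 / 2) (m + 1) p.1 z / den p.1 z =
      leadCoeff m s p.1 (theta (2 * s - 1 / 2) (m + 1) p.1) * appell m s p.1 z +
      ∑ k : Fin m, thetaCoeff m s p.1 (theta (2 * s - 1 / 2) (m + 1) p.1) k *
        theta (2 * (s + (k : ℕ))) m p.1 z := by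
    intro z hz
    rw [appell, (hasSum_appell hm1 s p.1.coe_im_pos hz).tsum_eq, hexp z, add_div, mul_div_assoc,
      Finset.sum_div]
    congr 1
    refine Finset.sum_congr rfl fun k _ => ?_
    rw [← mul_assoc, mul_div_cancel_right₀ _ hz]
  have e1 := hquot p.2 h1
  have e2 := hquot (-p.2) h2
  have e3 : ex (((m / 16 : ℝ) : ℂ) * p.1) * ex (((-(m : ℝ) / 16 : ℝ) : ℂ) * p.1) = 1 := by
    rw [← ex_add, ← ex_zero]
    congr 1
    push_cast
    ring
  change theta _ _ _ _ / theta _ _ _ _ - theta _ _ _ _ / theta _ _ _ _ =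
    _ * Phi _ _ _ _ _ _ + ∑ k : Fin m, _ * (theta _ _ _ _ - theta _ _ _ _)
  rw [Phi_eq_appell, ← den_neg, theta_neg_left, ← den, e1, e2]
  simp_rw [theta_neg_left, mul_sub]
  rw [Finset.sum_sub_distrib]
  linear_combination (leadCoeff m s p.1 (theta (2 * s - 1 / 2) (m + 1) p.1) *
    (appell m s p.1 (-p.2) - appell m s p.1 p.2)) * e3

/-! ### Comparison of the spans -/

theorem mul_mem_of_mem_qFrac (S : Submodule qFrac Fun) {x y : Fun} (hx : x ∈ qFrac) (hy : y ∈ S) :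
    x * y ∈ S :=
  S.smul_mem ⟨x, hx⟩ hy

theorem thetaOdd_neg (κ : ℝ) (m : ℕ) : thetaOdd (-κ) m = -thetaOdd κ m := by
  refine Germ.coe_eq.2 (Eventually.of_forall fun p => ?_)
  change theta _ _ _ _ - theta _ _ _ _ = -(theta _ _ _ _ - theta _ _ _ _)
  rw [neg_neg, neg_sub]

theorem thetaOdd_add_period {m : ℕ} (hm : 0 < m) (κ : ℝ) (n : ℤ) :
    thetaOdd (κ + n * (2 * m)) m = thetaOdd κ m := by
  have hm0 : (m : ℝ) ≠ 0 := by positivity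
  refine Germ.coe_eq.2 (Eventually.of_forall fun p => ?_)
  change theta _ _ _ _ - theta _ _ _ _ = theta _ _ _ _ - theta _ _ _ _
  rw [theta_neg_left, theta_neg_left, theta_add_int_mul_period _ hm0,
    theta_add_int_mul_period _ hm0]

theorem thetaOdd_zero (m : ℕ) : thetaOdd 0 m = 0 := by
  refine Germ.coe_eq.2 (Eventually.of_forall fun p => ?_)
  change theta _ _ _ _ - theta _ _ _ _ = 0
  rw [neg_zero, sub_self]

theorem thetaOdd_self {m : ℕ} (hm : 0 < m) : thetaOdd m m = 0 := by
  have hm0 : (m : ℝ) ≠ 0 := by positivity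
  refine Germ.coe_eq.2 (Eventually.of_forall fun p => ?_)
  change theta _ _ _ _ - theta _ _ _ _ = 0
  rw [← theta_add_period (-(m : ℝ)) hm0, show -(m : ℝ) + 2 * m = m by ring, sub_self]

/-- The index matters only modulo `2m` and up to sign, and `0` and `m` give zero; hence it reduces
to `1, …, m - 1`. Both reductions preserve parity. -/
theorem thetaOdd_mem {m : ℕ} (hm : 0 < m) (S : Submodule qFrac Fun) (n : ℤ)
    (h : ∀ k : ℕ, (k : ℤ) % 2 = n % 2 → 1 ≤ k → k + 1 ≤ m → thetaDiff k m ∈ S) :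
    thetaOdd n m ∈ S := by
  have hpos : (0 : ℤ) < 2 * m := by positivity
  have h0 := Int.emod_nonneg n hpos.ne'
  have h1 := Int.emod_lt_of_pos n hpos
  have h2 := Int.emod_add_mul_ediv n (2 * m)
  obtain ⟨r, hr⟩ := Int.eq_ofNat_of_zero_le h0
  rw [hr] at h1 h2
  have hpar : (r : ℤ) % 2 = n % 2 := by
    rw [← h2, mul_assoc, Int.add_mul_emod_self_left]
  have e : thetaOdd n m = thetaOdd r m := by
    have h3 : (n : ℝ) = r + ((n / (2 * m) : ℤ) : ℝ) * (2 * m) := by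
      rw [mul_comm]
      exact_mod_cast h2.symm
    rw [h3, thetaOdd_add_period hm]
  rw [e]
  rcases Nat.lt_trichotomy r m with hlt | heq | hgt
  · rcases Nat.eq_zero_or_pos r with h4 | h4
    · rw [h4, Nat.cast_zero, thetaOdd_zero]
      exact S.zero_mem
    · exact h r hpar h4 hlt
  · rw [heq, thetaOdd_self hm]
    exact S.zero_mem
  · obtain ⟨k, hk⟩ : ∃ k : ℕ, r + k = 2 * m := ⟨2 * m - r, by omega⟩
    have e2 : thetaOdd r m = -thetaOdd k m := by
      rw [← thetaOdd_neg, ← thetaOdd_add_period hm (-(k : ℝ)) 1]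
      congr 1
      have : (r : ℝ) + k = 2 * m := by exact_mod_cast hk
      push_cast
      linarith
    rw [e2]
    exact S.neg_mem (h k (by omega) (by omega) (by omega))

theorem phiFun_sub_mem {m : ℕ} (hm : 0 < m) (S : Submodule qFrac Fun) (s : ℝ)
    (h : thetaOdd (2 * s) m ∈ S) : phiFun m s - phiFun m (s + 1) ∈ S := by
  rw [phiFun_sub_phiFun_add_one hm]
  exact mul_mem_of_mem_qFrac S (coef_mem_qFrac (mul_ex_mem_qInt _ _)) h

theorem coef_mul_coef_cancel {φ ψ : UpperHalfPlane → ℂ}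
    (h : ∀ᶠ p : UpperHalfPlane × ℂ in denseOpen (UpperHalfPlane × ℂ), φ p.1 * ψ p.1 = 1) (x : Fun) :
    coef φ * (coef ψ * x) = x := by
  have e : coef φ * coef ψ = 1 := Germ.coe_eq.2 h
  rw [← mul_assoc, e, one_mul]

theorem thetaOdd_mem_of_phiFun_mem {m : ℕ} (hm : 0 < m) (S : Submodule qFrac Fun) (s : ℝ)
    (h : phiFun m s ∈ S) (h' : phiFun m (s + 1) ∈ S) : thetaOdd (2 * s) m ∈ S := by
  have h1 := S.sub_mem h h'
  rw [phiFun_sub_phiFun_add_one hm] at h1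
  set b : ℝ := -m / 16 + s / 2 - s ^ 2 / m
  have h2 := mul_mem_of_mem_qFrac S (coef_mem_qFrac (mul_ex_mem_qInt (ex (s / 2)) (-b))) h1
  rwa [coef_mul_coef_cancel (Eventually.of_forall fun p => ?_)] at h2
  rw [← ex_add, ← ex_add, ← ex_add, ← ex_zero]
  congr 1
  push_cast
  ring

theorem thetaRatio_mem {m : ℕ} (hm : 0 < m) (S : Submodule qFrac Fun) {s : ℝ} {C : ℤ}
    (hs : 2 * s = C) (h : phiFun m s ∈ S)
    (hθ : ∀ k : Fin m, thetaOdd (2 * (s + (k : ℕ))) m ∈ S) :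
    thetaRatio (2 * s - 1 / 2) m ∈ S := by
  rw [thetaRatio_eq hm hs]
  exact S.add_mem (mul_mem_of_mem_qFrac S (coef_mul_mem_qFrac (coef_leadCoeff_mem_qFrac hm hs)
    (coef_mem_qFrac (mul_ex_mem_qInt _ _))) h) (S.sum_mem fun k _ =>
      mul_mem_of_mem_qFrac S (coef_thetaCoeff_mem_qFrac hm hs k) (hθ k))

theorem phiFun_mem_of_thetaRatio_mem {m : ℕ} (hm : 0 < m) (S : Submodule qFrac Fun) {s : ℝ} {C : ℤ}
    (hs : 2 * s = C) (h1 : 1 / 2 ≤ s) (h2 : s ≤ (m + 1) / 2)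
    (h : thetaRatio (2 * s - 1 / 2) m ∈ S)
    (hθ : ∀ k : Fin m, thetaOdd (2 * (s + (k : ℕ))) m ∈ S) : phiFun m s ∈ S := by
  have hm1 : (1 : ℝ) ≤ m := by exact_mod_cast hm
  rw [thetaRatio_eq hm hs] at h
  have h3 := (S.add_mem_iff_left (S.sum_mem fun k _ =>
    mul_mem_of_mem_qFrac S (coef_thetaCoeff_mem_qFrac hm hs k) (hθ k))).1 h
  have h4 := mul_mem_of_mem_qFrac S (coef_mul_mem_qFrac (coef_leadCoeff_inv_mem_qFrac hm hs h1 h2)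
    (coef_mem_qFrac (mul_ex_mem_qInt 1 (-m / 16)))) h3
  rwa [coef_mul_coef_cancel] at h4
  filter_upwards [eventually_ne_zero_of_mem_qInt (theta_half_sub_mem_qInt m hs)
    (theta_half_sub_ne_zero m h1 h2), eventually_ne_zero_of_mem_qInt
    (prodSum_half_sub_mem_qInt hm1 s) (prodSum_half_sub_ne_zero hm1 s)] with p h5 h6
  have h7 : leadCoeff m s p.1 (theta (2 * s - 1 / 2) (m + 1) p.1) ≠ 0 := div_ne_zero h5 h6
  have e3 : ex (((-(m : ℝ) / 16 : ℝ) : ℂ) * p.1) * ex (((m / 16 : ℝ) : ℂ) * p.1) = 1 := by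
    rw [← ex_add, ← ex_zero]
    congr 1
    push_cast
    ring
  rw [one_mul, one_mul, mul_mul_mul_comm, inv_mul_cancel₀ h7, one_mul, e3]

theorem VHalf_eq_UHalf {m : ℕ} (hm : 0 < m) : VHalf m = UHalf m := by
  have hm1 : (1 : ℝ) ≤ m := by exact_mod_cast hm
  have hs : 2 * (1 / 2 : ℝ) = ((1 : ℤ) : ℝ) := by norm_num
  have hc : 2 * (1 / 2 : ℝ) - 1 / 2 = 1 / 2 := by norm_num
  have hidx : ∀ i : ℕ, 2 * (1 / 2 + (i : ℝ)) = ((2 * i + 1 : ℤ) : ℝ) := by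
    intro i
    push_cast
    ring
  apply le_antisymm
  · have hθ : ∀ i : ℕ, thetaOdd (2 * (1 / 2 + (i : ℝ))) m ∈ UHalf m := by
      intro i
      rw [hidx]
      refine thetaOdd_mem hm _ _ fun k hk h1 h2 => Submodule.subset_span (Or.inr ⟨k, ?_, h1, h2, rfl⟩)
      rw [Nat.odd_iff]
      omega
    -- Start at `s = 1/2`, where the theta quotient gives `Φ`, and telescope upward.
    have hφ : ∀ i : ℕ, phiFun m (1 / 2 + i) ∈ UHalf m := by
      intro i
      induction i with
      | zero =>
        rw [Nat.cast_zero, add_zero]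
        refine phiFun_mem_of_thetaRatio_mem hm _ hs le_rfl (by linarith) ?_ fun k => hθ k
        rw [hc]
        exact Submodule.subset_span (Or.inl rfl)
      | succ i ih =>
        have := (UHalf m).sub_mem ih (phiFun_sub_mem hm _ _ (hθ i))
        rw [sub_sub_cancel] at this
        rwa [Nat.cast_succ, ← add_assoc]
    refine Submodule.span_le.2 ?_
    rintro _ ⟨s, ⟨n, ⟨l, rfl⟩, rfl⟩, h1, -, rfl⟩
    have h3 : (0 : ℤ) ≤ l := by
      push_cast at h1
      have : (0 : ℝ) ≤ l := by linarith
      exact_mod_cast this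
    obtain ⟨i, rfl⟩ := Int.eq_ofNat_of_zero_le h3
    have e : ((2 * (i : ℤ) + 1 : ℤ) : ℝ) / 2 = 1 / 2 + i := by
      push_cast
      ring
    have := hφ i
    rw [← e] at this
    exact this
  · have hdiff : ∀ k : ℕ, Odd k → 1 ≤ k → k + 1 ≤ m → thetaDiff k m ∈ VHalf m := by
      rintro _ ⟨i, rfl⟩ - h2
      have h3 : (((2 * i + 1 : ℕ) : ℝ)) + 1 ≤ m := by exact_mod_cast h2
      have hi : (0 : ℝ) ≤ i := by positivity
      push_cast at h3
      -- For `k = 2s`, the bound `k + 1 ≤ m` says exactly that `s + 1 ≤ (m+1)/2`, so `s` and `s + 1`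
      -- both index generators.
      have := thetaOdd_mem_of_phiFun_mem hm (VHalf m) (1 / 2 + i)
        (Submodule.subset_span ⟨_, ⟨2 * i + 1, ⟨i, rfl⟩, by push_cast; ring⟩, by linarith,
          by linarith, rfl⟩)
        (Submodule.subset_span ⟨_, ⟨2 * (i + 1) + 1, ⟨i + 1, rfl⟩, by push_cast; ring⟩, by linarith,
          by linarith, rfl⟩)
      rw [hidx] at this
      exact_mod_cast this
    have hratio : thetaRatio (1 / 2) m ∈ VHalf m := by
      rw [← hc]
      refine thetaRatio_mem hm _ hs (Submodule.subset_span ⟨_, ⟨1, odd_one, by norm_num⟩, le_rfl,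
        by linarith, rfl⟩) fun k => ?_
      rw [hidx]
      refine thetaOdd_mem hm _ _ fun k' hk h1 h2 => hdiff k' ?_ h1 h2
      rw [Nat.odd_iff]
      omega
    refine Submodule.span_le.2 ?_
    rintro _ (rfl | ⟨k, hk, h1, h2, rfl⟩)
    · exact hratio
    · exact hdiff k hk h1 h2

theorem VZero_eq_UZero {m : ℕ} (hodd : Odd m) : VZero m = UZero m := by
  obtain ⟨d, hd⟩ := hodd
  have hm : 0 < m := by omega
  have hd0 : (0 : ℝ) ≤ d := by positivity
  have hmd : (m : ℝ) = 2 * d + 1 := by exact_mod_cast hd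
  have hs : 2 * ((d : ℝ) + 1) = ((2 * (d + 1) : ℤ) : ℝ) := by push_cast; ring
  have hc : 2 * ((d : ℝ) + 1) - 1 / 2 = m + 1 / 2 := by rw [hmd]; ring
  apply le_antisymm
  · have hθ : ∀ n : ℤ, thetaOdd (2 * (n : ℝ)) m ∈ UZero m := by
      intro n
      have e : 2 * (n : ℝ) = ((2 * n : ℤ) : ℝ) := by push_cast; ring
      rw [e]
      refine thetaOdd_mem hm _ _ fun k hk h1 h2 => Submodule.subset_span (Or.inr ⟨k, ?_, h1, h2, rfl⟩)
      rw [Nat.even_iff]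
      omega
    -- Here the start is the top value `s = d + 1 = (m+1)/2`, an integer because `m = 2d + 1`, and
    -- the telescoping runs downward.
    have hφ : ∀ i : ℕ, phiFun m (d + 1 - i) ∈ UZero m := by
      intro i
      induction i with
      | zero =>
        rw [Nat.cast_zero, sub_zero]
        refine phiFun_mem_of_thetaRatio_mem hm _ hs (by linarith) (by linarith) ?_ fun k => ?_
        · rw [hc]
          exact Submodule.subset_span (Or.inl rfl)
        · have := hθ (d + 1 + (k : ℕ))
          push_cast at this
          exact this
      | succ i ih =>
        have h1 := hθ (d + 1 - (i + 1))
        push_cast at h1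
        have := (UZero m).add_mem (phiFun_sub_mem hm _ _ h1) ih
        rw [show (d : ℝ) + 1 - (i + 1) + 1 = d + 1 - i by ring, sub_add_cancel] at this
        rwa [Nat.cast_succ]
    refine Submodule.span_le.2 ?_
    rintro _ ⟨s, ⟨n, rfl⟩, -, h2, rfl⟩
    have h3 : (0 : ℤ) ≤ d + 1 - n := by
      have : (0 : ℝ) ≤ d + 1 - n := by linarith
      exact_mod_cast this
    obtain ⟨i, hi⟩ := Int.eq_ofNat_of_zero_le h3
    have h4 : (d : ℝ) + 1 - n = i := by exact_mod_cast hi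
    have := hφ i
    rwa [← h4, sub_sub_cancel] at this
  · have hdiff : ∀ k : ℕ, Even k → 1 ≤ k → k + 1 ≤ m → thetaDiff k m ∈ VZero m := by
      rintro _ ⟨i, rfl⟩ h1 h2
      have hi : (1 : ℝ) ≤ i := by
        have : 1 ≤ i := by omega
        exact_mod_cast this
      have h3 : (i : ℝ) + i + 1 ≤ m := by exact_mod_cast h2
      have := thetaOdd_mem_of_phiFun_mem hm (VZero m) i
        (Submodule.subset_span ⟨_, ⟨i, by push_cast; ring⟩, hi, by linarith, rfl⟩)
        (Submodule.subset_span ⟨_, ⟨i + 1, by push_cast; ring⟩, by linarith, by linarith, rfl⟩)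
      rw [two_mul] at this
      exact_mod_cast this
    have hratio : thetaRatio (m + 1 / 2) m ∈ VZero m := by
      rw [← hc]
      refine thetaRatio_mem hm _ hs (Submodule.subset_span ⟨_, ⟨d + 1, by push_cast; ring⟩,
        by linarith, by linarith, rfl⟩) fun k => ?_
      have e : 2 * ((d : ℝ) + 1 + (k : ℕ)) = ((2 * (d + 1 + (k : ℕ)) : ℤ) : ℝ) := by push_cast; ring
      rw [e]
      refine thetaOdd_mem hm _ _ fun k' hk h1 h2 => hdiff k' ?_ h1 h2
      rw [Nat.even_iff]
      omega
    refine Submodule.span_le.2 ?_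
    rintro _ (rfl | ⟨k, hk, h1, h2, rfl⟩)
    · exact hratio
    · exact hdiff k hk h1 h2

end

end ThetaSpan

theorem lemman3 (m : ℕ) (hm : 0 < m) :
    (Odd m → ThetaSpan.VZero m = ThetaSpan.UZero m) ∧
      ThetaSpan.VHalf m = ThetaSpan.UHalf m :=
  ⟨fun h => ThetaSpan.VZero_eq_UZero h, ThetaSpan.VHalf_eq_UHalf hm⟩
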